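/- **Setting.** For $\kappa\in\mathbb N$ let $\mathbf L_2([\kappa]^d)$ be the real functions on $[\kappa]^d=\{1,\dots,\kappa\}^d$ with $\langle U,V\rangle=\kappa^{-d}\sum_x U(x)V(x)$. For $\Gamma\in \mathbf L_2([\kappa]^2)\otimes \mathbf L_2([\kappa]^2)$ put $\Gamma[U,V]=\kappa^{-4}\sum_{x,y\in[\kappa]^2}\Gamma(x,y)U(x)V(y)$ and $\|\Gamma\|_{op}=\sup_{\|U\|=\|V\|=1}\Gamma[U,V]$. The projection onto the span of orthonormal functions $f_j$ is identified with $\sum_j f_j\otimes f_j$, and $\Gamma\times_x\mathcal P\times_y\mathcal Q$ is defined by $(\Gamma\times_x\mathcal P\times_y\mathcal Q)[U,V]=\Gamma[\mathcal PU,\mathcal QV]$. Let $\alpha>0$ and $N\to\infty$; the resolution $\kappa\ge 1$, the rank $r\ge 1$, the dimensions $m,\ell$ and all objects below may depend on $N$. Let $\phi_1,\dots,\phi_\kappa$ be an orthonormal basis of $\mathbf L_2([\kappa])$ (for example discrete wavelets) and $c_1k^{-2\alpha}\le\gamma_k\le c_2k^{-2\alpha}$ for $1\le k\le\kappa$. For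 $A\in \mathbf L_2([\kappa]^4)$ let $$\|A\|^2_{\mathcal H([\kappa]^4)}=\sum_{k_1,\dots,k_4=1}^\kappa(\gamma_{k_1}\gamma_{k_2}\gamma_{k_3}\gamma_{k_4})^{-1}\big(A[\phi_{k_1},\phi_{k_2},\phi_{k_3},\phi_{k_4}]\big)^2 ,$$ where $A[\phi_{k_1},\dots,\phi_{k_4}]=\kappa^{-4}\sum_{x,y\in[\kappa]^2}A(x,y)\,\phi_{k_1}(x_1)\phi_{k_2}(x_2)\phi_{k_3}(y_1)\phi_{k_4}(y_2)$. Let $\mathcal M=\mathrm{span}\{\phi_{\mu_1}(x_1)\phi_{\mu_2}(x_2)\}_{1\le\mu_1,\mu_2\le m}$ and $\mathcal L=\mathrm{span}\{\phi_{\eta_1}(y_1)\phi_{\eta_2}(y_2)\}_{1\le\eta_1,\eta_2\le\ell}$ (indices above $\kappa$ are ignored). One observes $W_i(x)=I_i(x)+\epsilon_i(x)$, $i=1,\dots,N$, $x\in[\kappa]^2$, where: - the $I_i$ are i.i.d. random functions with $\mathbb E I_i(x)=I^*(x)$ and $\mathrm{Cov}(I_i(x),I_i(y))=\Sigma^*(x,y)$,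 and they are sub-Gaussian: $\langle I_i-I^*,f\rangle$ is sub-Gaussian with variance proxy $C_\delta^2\|f\|^2$ for every $f\in\mathbf L_2([\kappa]^2)$; - the $\epsilon_i(x)$ are i.i.d. over all $(i,x)$, independent of the $I_i$, and $\epsilon_i(x)-\mathbb E\epsilon_i(x)$ is sub-Gaussian with variance proxy $C_\epsilon^2$. Let $\overline W=\frac1N\sum_i W_i$ and $\widehat\Sigma(x,y)=\frac1{N-1}\sum_{i=1}^N(W_i(x)-\overline W(x))(W_i(y)-\overline W(y))$. Suppose $\Sigma^*(x,y)=\sum_{\rho=1}^r\sigma_\rho\Phi^*_\rho(x)\Phi^*_\rho(y)$ with $\sigma_1\ge\dots\ge\sigma_r>0$ and orthonormal $\Phi^*_\rho\in\mathbf L_2([\kappa]^2)$, and $\|\Sigma^*\|_{\mathcal H([\kappa]^4)}\le B$. Here $c_1,c_2,B,C_\delta,C_\epsilon$ do not depend on $N$. **Claim.** There is a constant $C>0$, depending only on $\alpha,c_1,c_2,B,C_\delta,C_\epsilon$, with the following property. Suppose that $m\asymp N^{1/(2\alpha+2)}$ and $1\le\ell=O(N^{1/(2\alpha+2)})$, and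 that for all sufficiently large $N$ $$|\sigma_r|>C\max\Big\{\ell^{-\alpha},\,m^{-\alpha},\,\frac{m+\ell}{\sqrt N},\,\frac1{\kappa^2}\Big\}.$$ Let $\mathcal P^*_x$ be the projection onto $\mathrm{span}\{\Phi^*_\rho\}_{\rho=1}^r$, and $\widehat{\mathcal P}_x$ the projection onto the span of the leading $r$ singular functions in the variable $x$ of $\widehat\Sigma\times_x\mathcal P_{\mathcal M}\times_y\mathcal P_{\mathcal L}$ (for any choice of the singular value decomposition). Then, as $N\to\infty$, $$\|\widehat{\mathcal P}_x-\mathcal P^*_x\|_{op}^2=O_{\mathbb P}\Big(\frac{\sigma_r^{-2}}{N^{2\alpha/(2\alpha+2)}}+\frac{\sigma_r^{-2}}{\kappa^4}\Big),$$ that is, for every $\eta>0$ there is $K>0$ such that the $\limsup_{N\to\infty}$ of the probability that the left side is at least $K$ times the bracket is less than $\eta$. -/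

import Mathlib

open MeasureTheory ProbabilityTheory Filter
open scoped ENNReal NNReal

noncomputable section

namespace ImagePCA

/-- The grid `[κ]² = [κ] × [κ]` of pixels. -/
abbrev Pixel (κ : ℕ) : Type := Fin κ × Fin κ

section L2

variable {X J : Type*} [Fintype X]

/-- The normalised inner product `⟨U, V⟩ = |X|⁻¹ ∑ₓ U(x) V(x)` of `L₂(X)`, for a finite grid `X`
(`|X| = κ` for `X = [κ]` and `|X| = κ²` for `X = [κ]²`). -/
def l2Inner (U V : X → ℝ) : ℝ :=
  (Fintype.card X : ℝ)⁻¹ * ∑ x, U x * V x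

/-- The norm of `L₂(X)`. -/
def l2Norm (U : X → ℝ) : ℝ := Real.sqrt (l2Inner U U)

/-- The functions `f j`, `j ∈ S`, are orthonormal in `L₂(X)`. -/
def OrthonormalOn (S : Finset J) (f : J → X → ℝ) : Prop :=
  (∀ j ∈ S, l2Inner (f j) (f j) = 1) ∧
    ∀ j ∈ S, ∀ k ∈ S, j ≠ k → l2Inner (f j) (f k) = 0

/-- The weak form `Γ[U, V] = |X|⁻² ∑ₓ ∑_y Γ(x, y) U(x) V(y)` of `Γ ∈ L₂(X) ⊗ L₂(X)`. -/
def pairing (Γ : X → X → ℝ) (U V : X → ℝ) : ℝ :=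
  ((Fintype.card X : ℝ)⁻¹) ^ 2 * ∑ x, ∑ y, Γ x y * U x * V y

/-- The operator norm of `L₂(X) ⊗ L₂(X)`:
the supremum of `Γ[U, V]` over `‖U‖ = ‖V‖ = 1`. -/
def opNorm (Γ : X → X → ℝ) : ℝ :=
  sSup {t : ℝ | ∃ U V : X → ℝ, l2Norm U = 1 ∧ l2Norm V = 1 ∧ t = pairing Γ U V}

/-- The element `∑_{j ∈ S} f j ⊗ f j` of `L₂(X) ⊗ L₂(X)`. When the `f j`, `j ∈ S`, are orthonormal,
it is the orthogonal projection of `L₂(X)` onto their span. -/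
def projKernel (S : Finset J) (f : J → X → ℝ) (x y : X) : ℝ :=
  ∑ j ∈ S, f j x * f j y

/-- The action `(P U)(x) = |X|⁻¹ ∑_y P(x, y) U(y)` of a kernel on `L₂(X)`. -/
def kernelApply (P : X → X → ℝ) (U : X → ℝ) (x : X) : ℝ :=
  (Fintype.card X : ℝ)⁻¹ * ∑ y, P x y * U y

/-- `A ×ₓ P ×_y Q`, the element of `L₂(X) ⊗ L₂(X)` with
`(A ×ₓ P ×_y Q)[U, V] = A[P U, Q V]`. -/
def sandwich (A P Q : X → X → ℝ) (x y : X) : ℝ :=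
  ((Fintype.card X : ℝ)⁻¹) ^ 2 * ∑ x', ∑ y', A x' y' * P x' x * Q y' y

/-- The defining property of `A ×ₓ P ×_y Q`. -/
theorem pairing_sandwich (A P Q : X → X → ℝ) (U V : X → ℝ) :
    pairing (sandwich A P Q) U V = pairing A (kernelApply P U) (kernelApply Q V) := by
  simp only [pairing, sandwich, kernelApply, Finset.mul_sum, Finset.sum_mul]
  have h1 : ∀ F : X → X → X → X → ℝ,
      (∑ x, ∑ y, ∑ x', ∑ y', F x y x' y') = ∑ x', ∑ y', ∑ y, ∑ x, F x y x' y' := by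
    intro F
    calc (∑ x, ∑ y, ∑ x', ∑ y', F x y x' y')
        = ∑ x, ∑ x', ∑ y, ∑ y', F x y x' y' := by
          refine Finset.sum_congr rfl fun x _ => Finset.sum_comm
      _ = ∑ x', ∑ x, ∑ y', ∑ y, F x y x' y' := by
          rw [Finset.sum_comm]
          refine Finset.sum_congr rfl fun x' _ => Finset.sum_congr rfl fun x _ => Finset.sum_comm
      _ = ∑ x', ∑ y', ∑ y, ∑ x, F x y x' y' := by
          refine Finset.sum_congr rfl fun x' _ => ?_
          rw [Finset.sum_comm]
          refine Finset.sum_congr rfl fun y' _ => Finset.sum_comm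
  rw [h1]
  refine Finset.sum_congr rfl fun x' _ => Finset.sum_congr rfl fun y' _ =>
    Finset.sum_congr rfl fun y _ => Finset.sum_congr rfl fun x _ => ?_
  ring

/-- `s₁ ≥ s₂ ≥ … ≥ 0`, `(u_k)`, `(v_k)`, `1 ≤ k ≤ |X|`, form a (full) singular value decomposition
`A(x, y) = ∑_k s_k u_k(x) v_k(y)` of `A ∈ L₂(X) ⊗ L₂(X)`. -/
structure IsSVD (A : X → X → ℝ) (s : ℕ → ℝ) (u v : ℕ → X → ℝ) : Prop where
  left_orthonormal : OrthonormalOn (Finset.Icc 1 (Fintype.card X)) u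
  right_orthonormal : OrthonormalOn (Finset.Icc 1 (Fintype.card X)) v
  antitone : AntitoneOn s (Set.Icc 1 (Fintype.card X))
  nonneg : ∀ k ∈ Set.Icc 1 (Fintype.card X), 0 ≤ s k
  eq_sum : ∀ x y, A x y = ∑ k ∈ Finset.Icc 1 (Fintype.card X), s k * u k x * v k y

/-- `Q` is the projection onto the span of the leading `r` singular functions in the variable `x`
of `A`, for some singular value decomposition of `A` (the choice matters only if the `r`-th and
the `(r+1)`-st singular value agree). -/
def IsLeadingProj (A : X → X → ℝ) (r : ℕ) (Q : X → X → ℝ) : Prop :=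
  ∃ (s : ℕ → ℝ) (u v : ℕ → X → ℝ), IsSVD A s u v ∧ Q = projKernel (Finset.Icc 1 r) u

/-- `A(x, y) = ∑_{ρ=1}^r σ_ρ Φ_ρ(x) Φ_ρ(y)` with `σ₁ ≥ … ≥ σ_r > 0` and orthonormal `Φ_ρ`. -/
structure IsSpectral (A : X → X → ℝ) (r : ℕ) (σ : ℕ → ℝ) (Φ : ℕ → X → ℝ) : Prop where
  one_le : 1 ≤ r
  antitone : AntitoneOn σ (Set.Icc 1 r)
  pos : 0 < σ r
  orthonormal : OrthonormalOn (Finset.Icc 1 r) Φ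
  eq_sum : ∀ x y, A x y = ∑ ρ ∈ Finset.Icc 1 r, σ ρ * Φ ρ x * Φ ρ y

end L2

section Grid

variable {κ : ℕ}

/-- The product functions `φ_{μ₁}(x₁) φ_{μ₂}(x₂)` on `[κ]²`. -/
def prodFun (φ : ℕ → Fin κ → ℝ) (μ : ℕ × ℕ) (x : Pixel κ) : ℝ :=
  φ μ.1 x.1 * φ μ.2 x.2

/-- The projection onto `span {φ_{μ₁}(x₁) φ_{μ₂}(x₂) : 1 ≤ μ₁, μ₂ ≤ m}`, for an orthonormal
basis `φ₁, …, φ_κ` of `L₂([κ])` (the whole of `L₂([κ]²)` if `m ≥ κ`). -/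
def subspaceProj (φ : ℕ → Fin κ → ℝ) (m : ℕ) : Pixel κ → Pixel κ → ℝ :=
  projKernel (Finset.Icc 1 (min m κ) ×ˢ Finset.Icc 1 (min m κ)) (prodFun φ)

/-- The squared norm of `H([κ]⁴)`:
`∑_{k₁,…,k₄ ≤ κ} (γ_{k₁} γ_{k₂} γ_{k₃} γ_{k₄})⁻¹ (A[φ_{k₁}, φ_{k₂}, φ_{k₃}, φ_{k₄}])²`. -/
def rkhsNormSq (γ : ℕ → ℝ) (φ : ℕ → Fin κ → ℝ) (A : Pixel κ → Pixel κ → ℝ) : ℝ :=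
  ∑ k₁ ∈ Finset.Icc 1 κ, ∑ k₂ ∈ Finset.Icc 1 κ, ∑ k₃ ∈ Finset.Icc 1 κ, ∑ k₄ ∈ Finset.Icc 1 κ,
    (γ k₁)⁻¹ * (γ k₂)⁻¹ * (γ k₃)⁻¹ * (γ k₄)⁻¹ *
      (pairing A (prodFun φ (k₁, k₂)) (prodFun φ (k₃, k₄))) ^ 2

/-- The sample mean image. -/
def sampleMean {N : ℕ} (w : Fin N → Pixel κ → ℝ) (x : Pixel κ) : ℝ :=
  (N : ℝ)⁻¹ * ∑ i, w i x

/-- The sample covariance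
`(N - 1)⁻¹ ∑ᵢ (Wᵢ(x) - W̄(x)) (Wᵢ(y) - W̄(y))` of `N` images. -/
def sampleCov {N : ℕ} (w : Fin N → Pixel κ → ℝ) (x y : Pixel κ) : ℝ :=
  ((N : ℝ) - 1)⁻¹ * ∑ i, (w i x - sampleMean w x) * (w i y - sampleMean w y)

/-- The signals `I₁, …, I_N` are i.i.d. sub-Gaussian random elements of `L₂([κ]²)` with parameter
`Cδ`, mean `Istar` and covariance `Sig`; the noise variables `ε i x` are i.i.d. sub-Gaussian with
parameter `Cε`; signals and noise are independent of each other. -/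
structure IsSignalNoise {Ω : Type*} [MeasurableSpace Ω] (P : Measure Ω) {N : ℕ}
    (I ε : Fin N → Pixel κ → Ω → ℝ) (Istar : Pixel κ → ℝ) (Sig : Pixel κ → Pixel κ → ℝ)
    (Cδ Cε : ℝ≥0) : Prop where
  signal_meas : ∀ i x, Measurable (I i x)
  signal_indep : iIndepFun (fun i ω x => I i x ω) P
  signal_ident : ∀ i j, IdentDistrib (fun ω x => I i x ω) (fun ω x => I j x ω) P P
  signal_mean : ∀ i x, ∫ ω, I i x ω ∂P = Istar x
  signal_cov : ∀ i x y, covariance (I i x) (I i y) P = Sig x y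
  signal_subgaussian : ∀ (i : Fin N) (f : Pixel κ → ℝ),
    HasSubgaussianMGF (fun ω => l2Inner (fun x => I i x ω - Istar x) f)
      (Cδ ^ 2 * (l2Norm f).toNNReal ^ 2) P
  noise_meas : ∀ i x, Measurable (ε i x)
  noise_indep : iIndepFun (fun (p : Fin N × Pixel κ) => ε p.1 p.2) P
  noise_ident : ∀ p q : Fin N × Pixel κ, IdentDistrib (ε p.1 p.2) (ε q.1 q.2) P P
  noise_subgaussian : ∀ i x,
    HasSubgaussianMGF (fun ω => ε i x ω - ∫ ω', ε i x ω' ∂P) (Cε ^ 2) P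
  signal_indep_noise : IndepFun (fun ω i x => I i x ω) (fun ω i x => ε i x ω) P

end Grid

/-- `X_n = O_P(a_n)`: for every `η > 0` there is `K > 0` with
`limsup P(|X_n / a_n| ≥ K) < η`. -/
def IsBigOP {Ω : ℕ → Type*} [∀ n, MeasurableSpace (Ω n)] (P : ∀ n, Measure (Ω n))
    (X : ∀ n, Ω n → ℝ) (a : ℕ → ℝ) : Prop :=
  ∀ η : ℝ, 0 < η → ∃ K : ℝ, 0 < K ∧
    limsup (fun n => P n {ω | K ≤ |X n ω / a n|}) atTop < ENNReal.ofReal η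

end ImagePCA

end

/-! Write `T` for the operator of `Σ*`, `Q_M` and `Q_L` for the two projections, and `A = Q_M Σ̂
Q_L`. The comparison operator is `T Q_L`, not `T`. Its range lies in the range `V` of `T`, so its
rank is at most `r`, and Weyl's inequality bounds the `(r+1)`-st singular value of `A` by `‖A - T
Q_L‖`. If `x` is orthogonal to the leading `r` left singular vectors, then `‖A* x‖ ≤ ‖A - T Q_L‖
‖x‖`, hence `‖Q_L T x‖ ≤ 2 ‖A - T Q_L‖ ‖x‖`. When `Q_L` moves the range of `T` by at most `σ_r / 2`,
one also has `‖Q_L T x‖ ≥ (σ_r / 2) ‖P_V x‖`. So the two `r`-dimensional spaces are close, with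
error of order `‖A - T Q_L‖ / σ_r` (`norm_leadingProjection_sub_le`). Consequently the bias in `y`,
of order `ℓ^{-α}`, enters only through the gap condition and never the rate; this is why a small `ℓ`
is allowed.

It remains to bound `A - T Q_L = Q_M (Σ̂ - Σ*) Q_L - (Σ* - Q_M Σ*) Q_L`. The second term is a bias
of order `m^{-α}`, since coefficients outside the first `m × m` product functions carry a small
weight in the RKHS norm (`norm_sub_gridSpan_le`). In the first term `Σ̂` has mean close to `Σ*` plus
a diagonal noise variance, whose operator norm is of order `κ^{-2}` in the normalised inner product.
The fluctuation has order `√((m² + ℓ²) / N)`, by Bernstein's inequality for products of sub-Gaussian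
scores and a union bound over nets of the two subspaces
(`IsSignalNoise.measure_norm_compression_gt_le`). With `m ≍ N^{1/(2α+2)}` bias and fluctuation are
both `O(N^{-α/(2α+2)})`. -/

namespace ImagePCA

/-! ### Perturbation of singular subspaces in a Euclidean space. -/

section Perturbation

open scoped InnerProductSpace

variable {E J : Type*} [NormedAddCommGroup E] [InnerProductSpace ℝ E]

theorem le_of_sq_le_mul {a c : ℝ} (hc : 0 ≤ c) (h : a ^ 2 ≤ c * a) : a ≤ c := by
  by_contra hlt
  push Not at hlt
  nlinarith [mul_pos (hc.trans_lt hlt) (sub_pos.2 hlt)]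

theorem norm_sq_sum_smul_orthonormal {S : Finset J} {f : J → E}
    (hf : Orthonormal ℝ (fun j : S => f j)) (a : J → ℝ) :
    ‖∑ j ∈ S, a j • f j‖ ^ 2 = ∑ j ∈ S, a j ^ 2 := by
  rw [← Finset.sum_coe_sort S (fun j => a j • f j), ← Finset.sum_coe_sort S (fun j => a j ^ 2),
    ← real_inner_self_eq_norm_sq,
    hf.inner_sum (fun j : S => a j) (fun j : S => a j) Finset.univ]
  simp [sq]

theorem inner_orthonormal_sum_smul {S : Finset J} {f : J → E}
    (hf : Orthonormal ℝ (fun j : S => f j)) (a : J → ℝ) {k : J} (hk : k ∈ S) :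
    ⟪f k, ∑ j ∈ S, a j • f j⟫_ℝ = a k := by
  rw [← Finset.sum_coe_sort S (fun j => a j • f j)]
  exact hf.inner_right_sum (fun j : S => a j) (Finset.mem_univ (⟨k, hk⟩ : S))

theorem sum_inner_sq_le_norm_sq {S : Finset J} {f : J → E}
    (hf : Orthonormal ℝ (fun j : S => f j)) (x : E) :
    ∑ j ∈ S, ⟪f j, x⟫_ℝ ^ 2 ≤ ‖x‖ ^ 2 := by
  rw [← Finset.sum_coe_sort S (fun j => ⟪f j, x⟫_ℝ ^ 2)]
  simpa using hf.sum_inner_products_le x (s := Finset.univ)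

theorem starProjection_span_apply_eq_sum [FiniteDimensional ℝ E] {S : Finset J} {f : J → E}
    (hf : Orthonormal ℝ (fun j : S => f j)) (x : E) :
    (Submodule.span ℝ (f '' S)).starProjection x = ∑ j ∈ S, ⟪f j, x⟫_ℝ • f j := by
  apply Submodule.eq_starProjection_of_mem_of_inner_eq_zero
  · exact Submodule.sum_mem _ fun j hj =>
      Submodule.smul_mem _ _ (Submodule.subset_span ⟨j, hj, rfl⟩)
  · intro w hw
    rw [real_inner_comm]
    induction hw using Submodule.span_induction with
    | mem w hw =>
      obtain ⟨k, hk, rfl⟩ := hw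
      rw [inner_sub_right, inner_orthonormal_sum_smul hf _ hk, sub_self]
    | zero => simp
    | add a b _ _ ha hb => rw [inner_add_left, ha, hb, add_zero]
    | smul c a _ ha => rw [inner_smul_left, ha, mul_zero]

theorem finrank_span_orthonormal {S : Finset J} {f : J → E}
    (hf : Orthonormal ℝ (fun j : S => f j)) :
    Module.finrank ℝ (Submodule.span ℝ (f '' S)) = S.card := by
  have h := finrank_span_eq_card hf.linearIndependent
  have e : Set.range (fun j : S => f j) = f '' S := by
    ext x; simp [Set.mem_image]
  rw [e] at h
  simpa using h

/-- Subspaces of equal dimension, one of which is close to the other, have close projections. -/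
theorem norm_starProjection_sub_le [FiniteDimensional ℝ E] (U V : Submodule ℝ E)
    (hUV : Module.finrank ℝ U = Module.finrank ℝ V) {s : ℝ} (hs : 0 ≤ s)
    (h : ∀ x ∈ U, ‖x - V.starProjection x‖ ≤ s * ‖x‖) :
    ‖V.starProjection - U.starProjection‖ ≤ 4 * s := by
  -- Two projections differ by at most `2`, so only `s < 1/2` has content.
  rcases le_or_gt (1 / 2) s with h2 | h2
  · calc ‖V.starProjection - U.starProjection‖
        ≤ ‖V.starProjection‖ + ‖U.starProjection‖ := norm_sub_le _ _
      _ ≤ 1 + 1 := add_le_add V.starProjection_norm_le U.starProjection_norm_le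
      _ ≤ 4 * s := by linarith
  have hlow : ∀ x ∈ U, ‖x‖ ≤ 2 * ‖V.starProjection x‖ := by
    intro x hx
    have h1 := h x hx
    have h3 : ‖x‖ ≤ ‖x - V.starProjection x‖ + ‖V.starProjection x‖ := by
      simpa using norm_add_le (x - V.starProjection x) (V.starProjection x)
    nlinarith [norm_nonneg x]
  -- The lower bound makes `P_V` injective on `U`; equal dimensions make it onto `V`. Every `w ∈ V`
  -- is thus `P_V z` with `z ∈ U` nearby, which reverses the roles of `U` and `V`.
  let g : U →ₗ[ℝ] V := (V.orthogonalProjectionOnto : E →ₗ[ℝ] V) ∘ₗ U.subtype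
  have hg : Function.Injective g := by
    rw [← LinearMap.ker_eq_bot, LinearMap.ker_eq_bot']
    intro x hx
    have h4 := hlow x x.2
    have : V.starProjection (x : E) = ((g x : V) : E) := rfl
    rw [this, hx] at h4
    simp only [ZeroMemClass.coe_zero, norm_zero, mul_zero, norm_le_zero_iff] at h4
    exact Subtype.ext h4
  have hgs : Function.Surjective g :=
    (LinearMap.injective_iff_surjective_of_finrank_eq_finrank hUV).1 hg
  have hback : ∀ w ∈ V, ‖w - U.starProjection w‖ ≤ 2 * s * ‖w‖ := by
    intro w hw
    obtain ⟨z, hz⟩ := hgs ⟨w, hw⟩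
    have hz' : V.starProjection (z : E) = w := congrArg Subtype.val hz
    have h5 := h z z.2
    have h6 := hlow z z.2
    rw [hz'] at h5 h6
    have h7 : w - U.starProjection w = (w - z) - U.starProjection (w - z) := by
      rw [map_sub, Submodule.starProjection_eq_self_iff.2 z.2]; abel
    have h8 : ‖(w - z) - U.starProjection (w - z)‖ ≤ ‖w - (z : E)‖ := by
      rw [← Submodule.starProjection_orthogonal_val]
      exact Uᗮ.norm_starProjection_apply_le _
    rw [h7]
    refine h8.trans ?_
    rw [norm_sub_rev]
    nlinarith [norm_nonneg w, norm_nonneg (z : E)]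
  refine ContinuousLinearMap.opNorm_le_bound _ (by linarith) fun x => ?_
  set p := U.starProjection x
  set y := x - p
  have hp : p ∈ U := Submodule.starProjection_apply_mem _ _
  have hpn : ‖p‖ ≤ ‖x‖ := U.norm_starProjection_apply_le x
  have hyn : ‖y‖ ≤ ‖x‖ := by
    have : y = Uᗮ.starProjection x := by rw [Submodule.starProjection_orthogonal_val]
    rw [this]; exact Uᗮ.norm_starProjection_apply_le x
  have hUy : U.starProjection y = 0 := by
    simp only [y, p, map_sub]
    rw [Submodule.starProjection_eq_self_iff.2 (Submodule.starProjection_apply_mem _ _), sub_self]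
  have hVy : ‖V.starProjection y‖ ≤ 2 * s * ‖y‖ := by
    set w := V.starProjection y
    have hw : w ∈ V := Submodule.starProjection_apply_mem _ _
    have h9 : ⟪w, w⟫_ℝ = ⟪w - U.starProjection w, y⟫_ℝ := by
      have e1 : ⟪w, w⟫_ℝ = ⟪w, y⟫_ℝ := by
        conv_lhs => rw [show ⟪w, w⟫_ℝ = ⟪w, V.starProjection y⟫_ℝ from rfl]
        rw [← Submodule.inner_starProjection_left_eq_right, Submodule.starProjection_eq_self_iff.2 hw]
      have e2 : ⟪U.starProjection w, y⟫_ℝ = 0 := by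
        rw [Submodule.inner_starProjection_left_eq_right, hUy, inner_zero_right]
      rw [inner_sub_left, e2, e1, sub_zero]
    have h10 := real_inner_le_norm (w - U.starProjection w) y
    rw [← h9, real_inner_self_eq_norm_sq] at h10
    have h11 := hback w hw
    have h12 := mul_le_mul_of_nonneg_right h11 (norm_nonneg y)
    exact le_of_sq_le_mul (by positivity) (by linarith)
  -- Splitting `x = p + y` along `U` and its complement: `p` is nearly fixed by `P_V`, and `y` is
  -- nearly killed by it because `V` is close to `U`.
  have e : (V.starProjection - U.starProjection) x = V.starProjection y - (p - V.starProjection p) := by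
    simp only [sub_apply, y, map_sub]; abel
  rw [e]
  calc _ ≤ ‖V.starProjection y‖ + ‖p - V.starProjection p‖ := norm_sub_le _ _
    _ ≤ 2 * s * ‖y‖ + s * ‖p‖ := add_le_add hVy (h p hp)
    _ ≤ 4 * s * ‖x‖ := by nlinarith [norm_nonneg x]

/-- Weyl's inequality for the approximation by an operator of rank at most `r`. -/
theorem singularValue_le_norm_sub {n r : ℕ} {s : ℕ → ℝ} {u v : ℕ → E}
    (hu : Orthonormal ℝ (fun k : Finset.Icc 1 n => u k))
    (hv : Orthonormal ℝ (fun k : Finset.Icc 1 n => v k))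
    (hs : AntitoneOn s (Set.Icc 1 n)) (hs0 : ∀ k ∈ Set.Icc 1 n, 0 ≤ s k)
    {A T : E →L[ℝ] E} (hA : ∀ x, A x = ∑ k ∈ Finset.Icc 1 n, (s k * ⟪v k, x⟫_ℝ) • u k)
    [FiniteDimensional ℝ E]
    (hT : Module.finrank ℝ (LinearMap.range (T : E →ₗ[ℝ] E)) ≤ r) (hr : r + 1 ≤ n) :
    s (r + 1) ≤ ‖A - T‖ := by
  classical
  -- The span of `v₁, …, v_{r+1}` has dimension `r + 1`, so it meets the kernel of `T` in some `w ≠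
  -- 0`; there `‖(A - T) w‖ = ‖A w‖ ≥ s_{r+1} ‖w‖`.
  let g : (Fin (r + 1) → ℝ) →ₗ[ℝ] LinearMap.range (T : E →ₗ[ℝ] E) :=
    (T : E →ₗ[ℝ] E).rangeRestrict ∘ₗ Fintype.linearCombination ℝ (fun i : Fin (r + 1) => v (i + 1))
  have hker : LinearMap.ker g ≠ ⊥ := by
    apply LinearMap.ker_ne_bot_of_finrank_lt
    rw [Module.finrank_fin_fun]; omega
  obtain ⟨a, ha, ha0⟩ := Submodule.exists_mem_ne_zero_of_ne_bot hker
  -- Coefficients shifted to start at index `1`; the values outside `1, …, r + 1` never enter the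
  -- sums.
  let b : ℕ → ℝ := fun k => if h : k - 1 < r + 1 then a ⟨k - 1, h⟩ else 0
  have hb : ∀ i : Fin (r + 1), b (i + 1) = a i := fun i => by
    simp only [b, Nat.add_sub_cancel]
    rw [dif_pos i.2]
  set S := Finset.Icc 1 (r + 1)
  have hsub : S ⊆ Finset.Icc 1 n := Finset.Icc_subset_Icc le_rfl hr
  set w := ∑ k ∈ S, b k • v k
  have hwa : w = Fintype.linearCombination ℝ (fun i : Fin (r + 1) => v (i + 1)) a := by
    rw [Fintype.linearCombination_apply]
    simp only [w, S]
    rw [← Finset.sum_coe_sort]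
    symm
    refine Finset.sum_bij (fun i _ => ⟨(i : ℕ) + 1, by simp; omega⟩) (by simp) ?_ ?_ ?_
    · intro i _ j _ h; ext; simpa using h
    · rintro ⟨k, hk⟩ _
      rw [Finset.mem_Icc] at hk
      exact ⟨⟨k - 1, by omega⟩, Finset.mem_univ _, by simp; omega⟩
    · intro i _
      simp only [hb]
  have hTw : T w = 0 := by
    have := LinearMap.mem_ker.1 ha
    have h2 := congrArg Subtype.val this
    rw [hwa]; simpa [g] using h2
  have hvS : Orthonormal ℝ (fun k : S => v k) :=
    hv.comp (fun k : S => (⟨k, hsub k.2⟩ : Finset.Icc 1 n)) fun i j h => by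
      ext; simpa using h
  have hwn : ‖w‖ ^ 2 = ∑ k ∈ S, b k ^ 2 := norm_sq_sum_smul_orthonormal hvS b
  have hpos : 0 < ‖w‖ ^ 2 := by
    rw [hwn]
    obtain ⟨i, hi⟩ := Function.ne_iff.1 ha0
    refine Finset.sum_pos' (fun k _ => sq_nonneg _) ⟨i + 1, ?_, ?_⟩
    · simp only [S, Finset.mem_Icc]; omega
    · rw [hb]; exact (sq_pos_of_ne_zero (by simpa using hi))
  have hAw : ‖A w‖ ^ 2 = ∑ k ∈ Finset.Icc 1 n, (s k * ⟪v k, w⟫_ℝ) ^ 2 := by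
    rw [hA, norm_sq_sum_smul_orthonormal hu]
  have hlow : (s (r + 1)) ^ 2 * ‖w‖ ^ 2 ≤ ‖A w‖ ^ 2 := by
    rw [hAw, hwn, Finset.mul_sum]
    calc ∑ k ∈ S, s (r + 1) ^ 2 * b k ^ 2 ≤ ∑ k ∈ S, (s k * ⟪v k, w⟫_ℝ) ^ 2 := by
          refine Finset.sum_le_sum fun k hk => ?_
          rw [inner_orthonormal_sum_smul hvS b hk, mul_pow]
          have hk' := Finset.mem_Icc.1 hk
          have h1 : s (r + 1) ≤ s k := hs ⟨hk'.1, by omega⟩ ⟨by omega, hr⟩ hk'.2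
          have h0 := hs0 (r + 1) ⟨by omega, hr⟩
          gcongr
      _ ≤ _ := Finset.sum_le_sum_of_subset_of_nonneg hsub fun _ _ _ => sq_nonneg _
  have hup : ‖A w‖ ≤ ‖A - T‖ * ‖w‖ := by
    have := (A - T).le_opNorm w
    simpa [hTw] using this
  have h0 := hs0 (r + 1) ⟨by omega, hr⟩
  have hw0 : 0 < ‖w‖ := by
    rcases (norm_nonneg w).lt_or_eq with h | h
    · exact h
    · rw [← h] at hpos; simp at hpos
  have h3 : s (r + 1) * ‖w‖ ≤ ‖A w‖ := by
    rw [← mul_pow] at hlow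
    exact le_of_sq_le_sq hlow (norm_nonneg _)
  exact le_of_mul_le_mul_right (h3.trans hup) hw0

/-- The adjoint sees only the components of `x` with index beyond `r`, where the singular values are
at most `s (r + 1)`, and Weyl's inequality bounds that by `‖A - T‖`. -/
theorem norm_adjoint_le_of_inner_leading_eq_zero {n r : ℕ} {s : ℕ → ℝ} {u v : ℕ → E}
    (hu : Orthonormal ℝ (fun k : Finset.Icc 1 n => u k))
    (hv : Orthonormal ℝ (fun k : Finset.Icc 1 n => v k))
    (hs : AntitoneOn s (Set.Icc 1 n)) (hs0 : ∀ k ∈ Set.Icc 1 n, 0 ≤ s k)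
    [FiniteDimensional ℝ E]
    {A T : E →L[ℝ] E} (hA : ∀ x, A x = ∑ k ∈ Finset.Icc 1 n, (s k * ⟪v k, x⟫_ℝ) • u k)
    (hT : Module.finrank ℝ (LinearMap.range (T : E →ₗ[ℝ] E)) ≤ r) {x : E}
    (hx : ∀ k ∈ Finset.Icc 1 r, ⟪u k, x⟫_ℝ = 0) :
    ‖ContinuousLinearMap.adjoint A x‖ ≤ ‖A - T‖ * ‖x‖ := by
  have hadj : ContinuousLinearMap.adjoint A x
      = ∑ k ∈ Finset.Icc 1 n, (s k * ⟪u k, x⟫_ℝ) • v k := by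
    refine ext_inner_right ℝ fun y => ?_
    rw [ContinuousLinearMap.adjoint_inner_left, hA, inner_sum, sum_inner]
    refine Finset.sum_congr rfl fun k _ => ?_
    rw [inner_smul_left, inner_smul_right, real_inner_comm x]
    simp; ring
  have hsq : ‖ContinuousLinearMap.adjoint A x‖ ^ 2 ≤ (‖A - T‖ * ‖x‖) ^ 2 := by
    rw [hadj, norm_sq_sum_smul_orthonormal hv, mul_pow]
    calc ∑ k ∈ Finset.Icc 1 n, (s k * ⟪u k, x⟫_ℝ) ^ 2
        ≤ ∑ k ∈ Finset.Icc 1 n, ‖A - T‖ ^ 2 * ⟪u k, x⟫_ℝ ^ 2 := by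
          refine Finset.sum_le_sum fun k hk => ?_
          rw [mul_pow]
          have hk' := Finset.mem_Icc.1 hk
          rcases le_or_gt k r with hkr | hkr
          · rw [hx k (Finset.mem_Icc.2 ⟨hk'.1, hkr⟩)]; simp
          · have h1 : s k ≤ s (r + 1) :=
              hs ⟨by omega, by omega⟩ ⟨by omega, by omega⟩ (by omega)
            have h2 := singularValue_le_norm_sub hu hv hs hs0 hA hT (by omega)
            have h0 := hs0 k ⟨hk'.1, hk'.2⟩
            have := h1.trans h2
            gcongr
      _ ≤ _ := by
          rw [← Finset.mul_sum]
          exact mul_le_mul_of_nonneg_left (sum_inner_sq_le_norm_sq hu x) (sq_nonneg _)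
  exact le_of_sq_le_sq hsq (by positivity)

/-- A one-sided form of Wedin's theorem: the leading left singular space of `A` is compared with
the range of the spectral operator `T`, where `A` is close to `T Q`, for a symmetric `Q` which
almost fixes the range of `T`. -/
theorem norm_leadingProjection_sub_le [FiniteDimensional ℝ E] {n r : ℕ} {s σ : ℕ → ℝ}
    {u v Φ : ℕ → E} (hrn : r ≤ n)
    (hu : Orthonormal ℝ (fun k : Finset.Icc 1 n => u k))
    (hv : Orthonormal ℝ (fun k : Finset.Icc 1 n => v k))
    (hs : AntitoneOn s (Set.Icc 1 n)) (hs0 : ∀ k ∈ Set.Icc 1 n, 0 ≤ s k)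
    (hΦ : Orthonormal ℝ (fun k : Finset.Icc 1 r => Φ k))
    (hσ : AntitoneOn σ (Set.Icc 1 r)) (hσ0 : 0 < σ r)
    {A T Q : E →L[ℝ] E} (hA : ∀ x, A x = ∑ k ∈ Finset.Icc 1 n, (s k * ⟪v k, x⟫_ℝ) • u k)
    (hT : ∀ x, T x = ∑ k ∈ Finset.Icc 1 r, (σ k * ⟪Φ k, x⟫_ℝ) • Φ k)
    (hQ : ∀ x y, ⟪Q x, y⟫_ℝ = ⟪x, Q y⟫_ℝ)
    (hTQ : ∀ x, ‖T x - Q (T x)‖ ≤ σ r / 2 * ‖x‖) :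
    ‖(Submodule.span ℝ (u '' (Finset.Icc 1 r : Finset ℕ))).starProjection -
      (Submodule.span ℝ (Φ '' (Finset.Icc 1 r : Finset ℕ))).starProjection‖
      ≤ 16 * ‖A - T.comp Q‖ / σ r := by
  have huS : Orthonormal ℝ (fun k : Finset.Icc 1 r => u k) :=
    hu.comp (fun k : Finset.Icc 1 r => (⟨k, Finset.Icc_subset_Icc le_rfl hrn k.2⟩ :
      Finset.Icc 1 n)) fun i j h => by ext; simpa using h
  set U := Submodule.span ℝ (u '' (Finset.Icc 1 r : Finset ℕ))
  set V := Submodule.span ℝ (Φ '' (Finset.Icc 1 r : Finset ℕ))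
  have hUV : Module.finrank ℝ V = Module.finrank ℝ U := by
    rw [finrank_span_orthonormal huS, finrank_span_orthonormal hΦ]
  have hrange : Module.finrank ℝ (LinearMap.range ((T.comp Q : E →L[ℝ] E) : E →ₗ[ℝ] E)) ≤ r := by
    have : LinearMap.range ((T.comp Q : E →L[ℝ] E) : E →ₗ[ℝ] E) ≤ V := by
      rintro _ ⟨x, rfl⟩
      simp only [ContinuousLinearMap.coe_coe, ContinuousLinearMap.comp_apply, hT]
      exact Submodule.sum_mem _ fun j hj =>
        Submodule.smul_mem _ _ (Submodule.subset_span ⟨j, hj, rfl⟩)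
    refine (Submodule.finrank_mono this).trans ?_
    rw [finrank_span_orthonormal hΦ]; simp
  have hTsymm : ∀ x y, ⟪T x, y⟫_ℝ = ⟪x, T y⟫_ℝ := by
    intro x y
    rw [hT, hT, inner_sum, sum_inner]
    refine Finset.sum_congr rfl fun k _ => ?_
    rw [inner_smul_left, inner_smul_right, real_inner_comm x]
    simp; ring
  have hPV : ∀ x, V.starProjection x = ∑ k ∈ Finset.Icc 1 r, ⟪Φ k, x⟫_ℝ • Φ k :=
    starProjection_span_apply_eq_sum hΦ
  have hΦV : ∀ k ∈ Finset.Icc 1 r, ∀ x, ⟪Φ k, V.starProjection x⟫_ℝ = ⟪Φ k, x⟫_ℝ := by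
    intro k hk x
    rw [hPV, inner_orthonormal_sum_smul hΦ _ hk]
  have hTV : ∀ x, T (V.starProjection x) = T x := by
    intro x
    rw [hT, hT]
    exact Finset.sum_congr rfl fun k hk => by rw [hΦV k hk]
  have hTlow : ∀ x, σ r * ‖V.starProjection x‖ ≤ ‖T x‖ := by
    intro x
    refine le_of_sq_le_sq ?_ (norm_nonneg _)
    rw [mul_pow, hPV, hT, norm_sq_sum_smul_orthonormal hΦ, norm_sq_sum_smul_orthonormal hΦ,
      Finset.mul_sum]
    refine Finset.sum_le_sum fun k hk => ?_
    rw [mul_pow]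
    have hk' := Finset.mem_Icc.1 hk
    have := hσ ⟨hk'.1, hk'.2⟩ ⟨hk'.1.trans hk'.2, le_rfl⟩ hk'.2
    gcongr
  have hQT : ∀ x, σ r / 2 * ‖V.starProjection x‖ ≤ ‖Q (T x)‖ := by
    intro x
    -- Applying the hypothesis to `P_V x` instead of `x`, which `T` does not distinguish, puts `‖P_V
    -- x‖` on the right; half of the lower bound `σ_r ‖P_V x‖` survives.
    have h1 := hTQ (V.starProjection x)
    rw [hTV] at h1
    have h2 := hTlow x
    have h3 : ‖T x‖ ≤ ‖T x - Q (T x)‖ + ‖Q (T x)‖ := by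
      simpa using norm_add_le (T x - Q (T x)) (Q (T x))
    linarith
  have hadj : ∀ x, ContinuousLinearMap.adjoint (T.comp Q) x = Q (T x) := by
    intro x
    refine ext_inner_right ℝ fun y => ?_
    rw [ContinuousLinearMap.adjoint_inner_left, ContinuousLinearMap.comp_apply, ← hTsymm, ← hQ]
  have key : ∀ x, (∀ k ∈ Finset.Icc 1 r, ⟪u k, x⟫_ℝ = 0) →
      ‖V.starProjection x‖ ≤ 4 * ‖A - T.comp Q‖ / σ r * ‖x‖ := by
    intro x hx
    have h1 := norm_adjoint_le_of_inner_leading_eq_zero hu hv hs hs0 hA hrange hx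
    have h2 : ‖ContinuousLinearMap.adjoint (T.comp Q) x‖
        ≤ ‖ContinuousLinearMap.adjoint A x‖ + ‖A - T.comp Q‖ * ‖x‖ := by
      have e : ContinuousLinearMap.adjoint (T.comp Q) x = ContinuousLinearMap.adjoint A x -
          ContinuousLinearMap.adjoint (A - T.comp Q) x := by
        rw [map_sub]; simp
      rw [e]
      refine (norm_sub_le _ _).trans (add_le_add le_rfl ?_)
      have := (ContinuousLinearMap.adjoint (A - T.comp Q)).le_opNorm x
      rwa [LinearIsometryEquiv.norm_map] at this
    rw [hadj] at h2
    have h3 := hQT x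
    rw [div_mul_eq_mul_div, le_div_iff₀ hσ0]
    nlinarith
  have hs' : 0 ≤ 4 * ‖A - T.comp Q‖ / σ r := by positivity
  refine (norm_starProjection_sub_le V U hUV hs' fun x hx => ?_).trans (le_of_eq (by ring))
  set w := x - U.starProjection x
  have hw : ∀ k ∈ Finset.Icc 1 r, ⟪u k, w⟫_ℝ = 0 := by
    intro k hk
    have h1 : w ∈ Uᗮ := Submodule.sub_starProjection_mem_orthogonal _
    exact (Submodule.mem_orthogonal _ _).1 h1 _ (Submodule.subset_span ⟨k, hk, rfl⟩)
  have h1 := key w hw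
  -- For `x ∈ V` the residual satisfies `‖w‖² = ⟪x, w⟫ = ⟪x, P_V w⟫`, so the bound on `P_V w` bounds
  -- `w` itself.
  have h2 : ⟪w, w⟫_ℝ = ⟪x, V.starProjection w⟫_ℝ := by
    have e1 : ⟪U.starProjection x, w⟫_ℝ = 0 := by
      have h1 : w ∈ Uᗮ := Submodule.sub_starProjection_mem_orthogonal _
      exact (Submodule.mem_orthogonal _ _).1 h1 _ (Submodule.starProjection_apply_mem _ _)
    rw [← Submodule.inner_starProjection_left_eq_right, Submodule.starProjection_eq_self_iff.2 hx]
    conv_lhs => enter [2]; rw [show w = x - U.starProjection x from rfl]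
    rw [inner_sub_left, e1, sub_zero]
  have h3 := real_inner_le_norm x (V.starProjection w)
  rw [← h2, real_inner_self_eq_norm_sq] at h3
  have h4 := mul_le_mul_of_nonneg_left h1 (norm_nonneg x)
  exact le_of_sq_le_mul (by positivity) (by linarith)

end Perturbation

/-! ### Kernels on a finite grid as operators on Euclidean space. -/

section Kernels

open scoped InnerProductSpace

variable {X J : Type*} [Fintype X]

/-- The isometric embedding of `L₂(X)` into the Euclidean space `ℝ^X`. -/
noncomputable def toEuclid : (X → ℝ) →ₗ[ℝ] EuclideanSpace ℝ X :=
  (Real.sqrt (Fintype.card X))⁻¹ • (WithLp.linearEquiv 2 ℝ (X → ℝ)).symm.toLinearMap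

theorem toEuclid_apply (U : X → ℝ) :
    toEuclid U = (Real.sqrt (Fintype.card X))⁻¹ • WithLp.toLp 2 U := rfl

theorem inner_toEuclid (U V : X → ℝ) : ⟪toEuclid U, toEuclid V⟫_ℝ = l2Inner U V := by
  rw [toEuclid_apply, toEuclid_apply, inner_smul_left, inner_smul_right, l2Inner, ← mul_assoc]
  congr 1
  · simp only [conj_trivial]
    rw [← mul_inv, Real.mul_self_sqrt (by positivity)]
  · simp [PiLp.inner_apply, mul_comm]

theorem norm_toEuclid (U : X → ℝ) : ‖toEuclid U‖ = l2Norm U := by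
  rw [l2Norm, ← inner_toEuclid, real_inner_self_eq_norm_sq, Real.sqrt_sq (norm_nonneg _)]

theorem toEuclid_surjective [Nonempty X] : Function.Surjective (toEuclid (X := X)) := by
  intro x
  have h : Real.sqrt (Fintype.card X) ≠ 0 := by positivity
  refine ⟨Real.sqrt (Fintype.card X) • WithLp.ofLp x, ?_⟩
  rw [toEuclid_apply, WithLp.toLp_smul, smul_smul, inv_mul_cancel₀ h, one_smul]

theorem orthonormal_toEuclid {S : Finset J} {f : J → X → ℝ} (hf : OrthonormalOn S f) :
    Orthonormal ℝ (fun j : S => toEuclid (f j)) := by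
  classical
  rw [orthonormal_iff_ite]
  intro i j
  rw [inner_toEuclid]
  split_ifs with h
  · rw [h]; exact hf.1 j j.2
  · exact hf.2 i i.2 j j.2 fun e => h (Subtype.ext e)

theorem OrthonormalOn.card_le {S : Finset J} {f : J → X → ℝ} (hf : OrthonormalOn S f) :
    S.card ≤ Fintype.card X := by
  simpa using (orthonormal_toEuclid hf).linearIndependent.fintype_card_le_finrank

theorem pairing_neg_right (A : X → X → ℝ) (U V : X → ℝ) :
    pairing A U (fun x => -V x) = -pairing A U V := by
  simp [pairing]

/-- Flipping the sign of `V` gives a nonnegative element of the set. For an empty set the supremum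
is `0` by convention. -/
theorem opNorm_nonneg (A : X → X → ℝ) : 0 ≤ opNorm A := by
  unfold opNorm
  rcases Set.eq_empty_or_nonempty
    {t : ℝ | ∃ U V : X → ℝ, l2Norm U = 1 ∧ l2Norm V = 1 ∧ t = pairing A U V} with h | h
  · rw [h]; simp
  · obtain ⟨t, U, V, hU, hV, rfl⟩ := h
    apply Real.sSup_nonneg'
    rcases le_total 0 (pairing A U V) with h0 | h0
    · exact ⟨_, ⟨U, V, hU, hV, rfl⟩, h0⟩
    · refine ⟨_, ⟨U, fun x => -V x, hU, ?_, (pairing_neg_right A U V).symm⟩, by linarith⟩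
      rw [← hV]; simp [l2Norm, l2Inner]

variable [DecidableEq X]

/-- The operator of `L₂(X)` with a given kernel, transported to `ℝ^X`. -/
noncomputable def kernelCLM (A : X → X → ℝ) : EuclideanSpace ℝ X →L[ℝ] EuclideanSpace ℝ X :=
  (Fintype.card X : ℝ)⁻¹ • Matrix.toEuclideanCLM (𝕜 := ℝ) (Matrix.of A)

theorem kernelCLM_toEuclid (A : X → X → ℝ) (V : X → ℝ) :
    kernelCLM A (toEuclid V) = toEuclid (kernelApply A V) := by
  rw [toEuclid_apply, toEuclid_apply, kernelCLM, map_smul, smul_apply,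
    Matrix.toEuclideanCLM_toLp, ← WithLp.toLp_smul]
  rfl

theorem inner_kernelCLM (A : X → X → ℝ) (U V : X → ℝ) :
    ⟪toEuclid U, kernelCLM A (toEuclid V)⟫_ℝ = pairing A U V := by
  rw [kernelCLM_toEuclid, inner_toEuclid, l2Inner, pairing, pow_two, mul_assoc]
  congr 1
  simp only [kernelApply, Finset.mul_sum]
  refine Finset.sum_congr rfl fun x _ => Finset.sum_congr rfl fun y _ => ?_
  ring

theorem kernelCLM_sub (A A' : X → X → ℝ) :
    kernelCLM (fun x y => A x y - A' x y) = kernelCLM A - kernelCLM A' := by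
  have h : Matrix.of (fun x y => A x y - A' x y) = Matrix.of A - Matrix.of A' := rfl
  rw [kernelCLM, h, map_sub]
  exact smul_sub _ _ _

theorem kernelCLM_add (A A' : X → X → ℝ) :
    kernelCLM (fun x y => A x y + A' x y) = kernelCLM A + kernelCLM A' := by
  have h : Matrix.of (fun x y => A x y + A' x y) = Matrix.of A + Matrix.of A' := rfl
  rw [kernelCLM, h, map_add]
  exact smul_add _ _ _

theorem kernelCLM_eq_sum [Nonempty X] {S : Finset J} {s : J → ℝ} {u v : J → X → ℝ}
    {A : X → X → ℝ} (hA : ∀ x y, A x y = ∑ k ∈ S, s k * u k x * v k y)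
    (x : EuclideanSpace ℝ X) :
    kernelCLM A x = ∑ k ∈ S, (s k * ⟪toEuclid (v k), x⟫_ℝ) • toEuclid (u k) := by
  obtain ⟨V, rfl⟩ := toEuclid_surjective x
  rw [kernelCLM_toEuclid]
  simp only [inner_toEuclid, ← map_smul, ← map_sum]
  congr 1
  ext x
  simp only [kernelApply, hA, Finset.sum_apply, Pi.smul_apply, smul_eq_mul, l2Inner]
  rw [Finset.mul_sum]
  simp only [Finset.sum_mul, Finset.mul_sum]
  rw [Finset.sum_comm]
  refine Finset.sum_congr rfl fun k _ => Finset.sum_congr rfl fun y _ => ?_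
  ring

theorem kernelCLM_projKernel [Nonempty X] {S : Finset J} {f : J → X → ℝ}
    (hf : OrthonormalOn S f) :
    kernelCLM (projKernel S f)
      = (Submodule.span ℝ ((fun j => toEuclid (f j)) '' S)).starProjection := by
  ext1 x
  rw [starProjection_span_apply_eq_sum (orthonormal_toEuclid hf),
    kernelCLM_eq_sum (S := S) (s := fun _ => 1) (u := f) (v := f)
      (fun x y => by simp [projKernel]) x]
  simp

theorem kernelCLM_sandwich [Nonempty X] (A P Q : X → X → ℝ) :
    kernelCLM (sandwich A P Q)
      = (ContinuousLinearMap.adjoint (kernelCLM P)).comp ((kernelCLM A).comp (kernelCLM Q)) := by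
  ext1 y
  refine ext_inner_left ℝ fun x => ?_
  obtain ⟨U, rfl⟩ := toEuclid_surjective x
  obtain ⟨V, rfl⟩ := toEuclid_surjective y
  rw [inner_kernelCLM, pairing_sandwich, ContinuousLinearMap.comp_apply,
    ContinuousLinearMap.comp_apply, ContinuousLinearMap.adjoint_inner_right,
    kernelCLM_toEuclid, kernelCLM_toEuclid, inner_kernelCLM]

theorem opNorm_le_norm_kernelCLM (A : X → X → ℝ) : opNorm A ≤ ‖kernelCLM A‖ := by
  refine Real.sSup_le ?_ (norm_nonneg _)
  rintro _ ⟨U, V, hU, hV, rfl⟩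
  rw [← inner_kernelCLM]
  refine (real_inner_le_norm _ _).trans ?_
  rw [norm_toEuclid, hU, one_mul]
  refine ((kernelCLM A).le_opNorm _).trans ?_
  rw [norm_toEuclid, hV, mul_one]

end Kernels

/-! ### Product bases, RKHS approximation and the deterministic bound. -/

section Grid

open scoped InnerProductSpace

variable {κ : ℕ}

theorem l2Inner_prodFun (φ : ℕ → Fin κ → ℝ) (μ ν : ℕ × ℕ) :
    l2Inner (prodFun φ μ) (prodFun φ ν) = l2Inner (φ μ.1) (φ ν.1) * l2Inner (φ μ.2) (φ ν.2) := by
  simp only [l2Inner, prodFun, Fintype.card_prod, Fintype.sum_prod_type, Nat.cast_mul, mul_inv]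
  rw [mul_mul_mul_comm, Finset.sum_mul_sum]
  congr 1
  refine Finset.sum_congr rfl fun x _ => Finset.sum_congr rfl fun y _ => ?_
  ring

theorem orthonormalOn_prodFun {φ : ℕ → Fin κ → ℝ} (hφ : OrthonormalOn (Finset.Icc 1 κ) φ)
    {n : ℕ} (hn : n ≤ κ) : OrthonormalOn (Finset.Icc 1 n ×ˢ Finset.Icc 1 n) (prodFun φ) := by
  have hsub : ∀ k ∈ Finset.Icc 1 n, k ∈ Finset.Icc 1 κ := fun k hk =>
    Finset.Icc_subset_Icc le_rfl hn hk
  constructor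
  · intro μ hμ
    rw [Finset.mem_product] at hμ
    rw [l2Inner_prodFun, hφ.1 _ (hsub _ hμ.1), hφ.1 _ (hsub _ hμ.2), one_mul]
  · intro μ hμ ν hν h
    rw [Finset.mem_product] at hμ hν
    rw [l2Inner_prodFun]
    by_cases h1 : μ.1 = ν.1
    · have h2 : μ.2 ≠ ν.2 := fun h2 => h (Prod.ext h1 h2)
      rw [hφ.2 _ (hsub _ hμ.2) _ (hsub _ hν.2) h2, mul_zero]
    · rw [hφ.2 _ (hsub _ hμ.1) _ (hsub _ hν.1) h1, zero_mul]

/-- The span of the product functions of index at most `n`. -/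
noncomputable def gridSpan (φ : ℕ → Fin κ → ℝ) (n : ℕ) : Submodule ℝ (EuclideanSpace ℝ (Pixel κ)) :=
  Submodule.span ℝ ((fun μ => toEuclid (prodFun φ μ)) ''
    (Finset.Icc 1 (min n κ) ×ˢ Finset.Icc 1 (min n κ) : Finset (ℕ × ℕ)))

theorem kernelCLM_subspaceProj (hκ : 1 ≤ κ) {φ : ℕ → Fin κ → ℝ}
    (hφ : OrthonormalOn (Finset.Icc 1 κ) φ) (n : ℕ) :
    kernelCLM (subspaceProj φ n) = (gridSpan φ n).starProjection := by
  have : Nonempty (Fin κ) := ⟨⟨0, hκ⟩⟩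
  exact kernelCLM_projKernel (orthonormalOn_prodFun hφ (min_le_right n κ))

theorem finrank_gridSpan {φ : ℕ → Fin κ → ℝ} (hφ : OrthonormalOn (Finset.Icc 1 κ) φ) (n : ℕ) :
    Module.finrank ℝ (gridSpan φ n) = (min n κ) ^ 2 := by
  rw [gridSpan, finrank_span_orthonormal (f := fun μ => toEuclid (prodFun φ μ))
    (orthonormal_toEuclid (orthonormalOn_prodFun hφ (min_le_right n κ)))]
  simp [sq]

theorem gridSpan_self {φ : ℕ → Fin κ → ℝ} (hφ : OrthonormalOn (Finset.Icc 1 κ) φ) :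
    gridSpan φ κ = ⊤ := by
  apply Submodule.eq_top_of_finrank_eq
  rw [finrank_gridSpan hφ]
  simp [sq]

theorem weight_le {α c₁ c₂ : ℝ} (hα : 0 < α) (hc₁ : 0 < c₁) (hc₂ : 0 < c₂) {γ : ℕ → ℝ}
    (hγ : ∀ k ∈ Finset.Icc 1 κ, c₁ * (k : ℝ) ^ (-2 * α) ≤ γ k ∧ γ k ≤ c₂ * (k : ℝ) ^ (-2 * α))
    {n k : ℕ} (hn : 1 ≤ n) (hk : k ∈ Finset.Icc 1 κ) (hnk : n ≤ k) :
    0 < γ k ∧ γ k ≤ c₂ * (n : ℝ) ^ (-2 * α) := by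
  have hk' := Finset.mem_Icc.1 hk
  have hk0 : (0 : ℝ) < k := by exact_mod_cast hk'.1
  have hn0 : (0 : ℝ) < n := by exact_mod_cast hn
  refine ⟨lt_of_lt_of_le (by positivity) (hγ k hk).1, (hγ k hk).2.trans ?_⟩
  refine mul_le_mul_of_nonneg_left ?_ hc₂.le
  exact Real.rpow_le_rpow_of_nonpos hn0 (by exact_mod_cast hnk) (by linarith)

/-- The approximation error of a covariance of bounded RKHS norm. -/
theorem norm_sub_gridSpan_le (hκ : 1 ≤ κ) {φ : ℕ → Fin κ → ℝ}
    (hφ : OrthonormalOn (Finset.Icc 1 κ) φ) {α c₁ c₂ B : ℝ} (hα : 0 < α) (hc₁ : 0 < c₁)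
    (hc₂ : 0 < c₂) {γ : ℕ → ℝ}
    (hγ : ∀ k ∈ Finset.Icc 1 κ, c₁ * (k : ℝ) ^ (-2 * α) ≤ γ k ∧ γ k ≤ c₂ * (k : ℝ) ^ (-2 * α))
    {A : Pixel κ → Pixel κ → ℝ} (hA : rkhsNormSq γ φ A ≤ B ^ 2) {n : ℕ} (hn : 1 ≤ n)
    (x : EuclideanSpace ℝ (Pixel κ)) :
    ‖kernelCLM A x - (gridSpan φ n).starProjection (kernelCLM A x)‖
      ≤ c₂ ^ 2 * |B| * (n : ℝ) ^ (-α) * ‖x‖ := by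
  have : Nonempty (Fin κ) := ⟨⟨0, hκ⟩⟩
  set T := Finset.Icc 1 κ ×ˢ Finset.Icc 1 κ
  set S := Finset.Icc 1 (min n κ) ×ˢ Finset.Icc 1 (min n κ)
  set e : ℕ × ℕ → EuclideanSpace ℝ (Pixel κ) := fun μ => toEuclid (prodFun φ μ) with he
  have hST : S ⊆ T := Finset.product_subset_product
    (Finset.Icc_subset_Icc le_rfl (min_le_right _ _)) (Finset.Icc_subset_Icc le_rfl (min_le_right _ _))
  have hT : Orthonormal ℝ (fun μ : T => e μ) := orthonormal_toEuclid (orthonormalOn_prodFun hφ le_rfl)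
  have hS : Orthonormal ℝ (fun μ : S => e μ) :=
    orthonormal_toEuclid (orthonormalOn_prodFun hφ (min_le_right _ _))
  have hTS : Orthonormal ℝ (fun μ : (T \ S : Finset (ℕ × ℕ)) => e μ) :=
    hT.comp (fun k : (T \ S : Finset (ℕ × ℕ)) => (⟨k, Finset.sdiff_subset k.2⟩ : T))
      fun i j h => Subtype.ext (by simpa using h)
  have hrep : ∀ z : EuclideanSpace ℝ (Pixel κ), z = ∑ μ ∈ T, ⟪e μ, z⟫_ℝ • e μ := by
    intro z
    have h1 := starProjection_span_apply_eq_sum hT z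
    have h2 : Submodule.span ℝ (e '' T) = ⊤ := by
      have := gridSpan_self hφ
      simpa [gridSpan, T, he] using this
    rwa [Submodule.starProjection_eq_self_iff.2 (h2 ▸ Submodule.mem_top)] at h1
  have hdiff : ∀ z : EuclideanSpace ℝ (Pixel κ), z - (gridSpan φ n).starProjection z
      = ∑ μ ∈ T \ S, ⟪e μ, z⟫_ℝ • e μ := by
    intro z
    have h1 : (gridSpan φ n).starProjection z = ∑ μ ∈ S, ⟪e μ, z⟫_ℝ • e μ :=
      starProjection_span_apply_eq_sum hS z
    rw [h1, Finset.sum_sdiff_eq_sub hST, ← hrep]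
  have hpair : ∀ μ ν, ⟪e μ, kernelCLM A (e ν)⟫_ℝ = pairing A (prodFun φ μ) (prodFun φ ν) :=
    fun μ ν => inner_kernelCLM _ _ _
  -- Cauchy–Schwarz in the index `ν`: the operator norm of the remainder is controlled by its
  -- Hilbert–Schmidt norm, which is what the RKHS norm weighs.
  have hcs : ∀ μ, ⟪e μ, kernelCLM A x⟫_ℝ ^ 2
      ≤ (∑ ν ∈ T, pairing A (prodFun φ μ) (prodFun φ ν) ^ 2) * ‖x‖ ^ 2 := by
    intro μ
    have h1 : ⟪e μ, kernelCLM A x⟫_ℝ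
        = ∑ ν ∈ T, pairing A (prodFun φ μ) (prodFun φ ν) * ⟪e ν, x⟫_ℝ := by
      conv_lhs => rw [hrep x]
      rw [map_sum, inner_sum]
      refine Finset.sum_congr rfl fun ν _ => ?_
      rw [map_smul, inner_smul_right, hpair, mul_comm]
    rw [h1]
    refine (Finset.sum_mul_sq_le_sq_mul_sq _ _ _).trans ?_
    exact mul_le_mul_of_nonneg_left (sum_inner_sq_le_norm_sq hT x)
      (Finset.sum_nonneg fun _ _ => sq_nonneg _)
  have hone : ∀ k ∈ Finset.Icc 1 κ, 0 < γ k ∧ γ k ≤ c₂ := fun k hk => by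
    simpa using weight_le hα hc₁ hc₂ hγ le_rfl hk (Finset.mem_Icc.1 hk).1
  set D := c₂ ^ 4 * (n : ℝ) ^ (-2 * α)
  have hD : 0 ≤ D := by positivity
  -- Outside `S` one of the two indices of `μ` exceeds `n`, so one factor is at most `c₂ n^{-2α}`;
  -- the other three are at most `c₂`.
  have hw : ∀ μ ∈ T \ S, ∀ ν ∈ T, γ μ.1 * γ μ.2 * γ ν.1 * γ ν.2 ≤ D := by
    intro μ hμ ν hν
    simp only [T, S, Finset.mem_sdiff, Finset.mem_product] at hμ hν
    obtain ⟨hμT, hμS⟩ := hμ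
    have a1 := hone _ hμT.1
    have a2 := hone _ hμT.2
    have a3 := hone _ hν.1
    have a4 := hone _ hν.2
    have hnn : (0 : ℝ) ≤ (n : ℝ) ^ (-2 * α) := by positivity
    have h12 : γ μ.1 * γ μ.2 ≤ c₂ ^ 2 * (n : ℝ) ^ (-2 * α) := by
      rcases le_or_gt n μ.1 with h | h
      · have := weight_le hα hc₁ hc₂ hγ hn hμT.1 h
        calc γ μ.1 * γ μ.2 ≤ (c₂ * (n : ℝ) ^ (-2 * α)) * c₂ :=
              mul_le_mul this.2 a2.2 a2.1.le (by positivity)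
          _ = _ := by ring
      rcases le_or_gt n μ.2 with h' | h'
      · have := weight_le hα hc₁ hc₂ hγ hn hμT.2 h'
        calc γ μ.1 * γ μ.2 ≤ c₂ * (c₂ * (n : ℝ) ^ (-2 * α)) :=
              mul_le_mul a1.2 this.2 a2.1.le hc₂.le
          _ = _ := by ring
      · exfalso
        apply hμS
        simp only [Finset.mem_Icc] at hμT ⊢
        omega
    have h34 : γ ν.1 * γ ν.2 ≤ c₂ * c₂ := mul_le_mul a3.2 a4.2 a4.1.le hc₂.le
    calc γ μ.1 * γ μ.2 * γ ν.1 * γ ν.2 = (γ μ.1 * γ μ.2) * (γ ν.1 * γ ν.2) := by ring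
      _ ≤ (c₂ ^ 2 * (n : ℝ) ^ (-2 * α)) * (c₂ * c₂) :=
          mul_le_mul h12 h34 (mul_nonneg a3.1.le a4.1.le) (by positivity)
      _ = D := by simp only [D]; ring
  have hR : ∑ μ ∈ T, ∑ ν ∈ T, (γ μ.1)⁻¹ * (γ μ.2)⁻¹ * (γ ν.1)⁻¹ * (γ ν.2)⁻¹ *
      pairing A (prodFun φ μ) (prodFun φ ν) ^ 2 ≤ B ^ 2 := by
    refine le_trans (le_of_eq ?_) hA
    simp only [rkhsNormSq, T, Finset.sum_product]
  have hterm0 : ∀ μ ∈ T, ∀ ν ∈ T, 0 ≤ (γ μ.1)⁻¹ * (γ μ.2)⁻¹ * (γ ν.1)⁻¹ * (γ ν.2)⁻¹ *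
      pairing A (prodFun φ μ) (prodFun φ ν) ^ 2 := by
    intro μ hμ ν hν
    simp only [T, Finset.mem_product] at hμ hν
    have a1 := (hone _ hμ.1).1
    have a2 := (hone _ hμ.2).1
    have a3 := (hone _ hν.1).1
    have a4 := (hone _ hν.2).1
    positivity
  have hsum : ∑ μ ∈ T \ S, ∑ ν ∈ T, pairing A (prodFun φ μ) (prodFun φ ν) ^ 2 ≤ D * B ^ 2 := by
    calc ∑ μ ∈ T \ S, ∑ ν ∈ T, pairing A (prodFun φ μ) (prodFun φ ν) ^ 2
        ≤ ∑ μ ∈ T \ S, ∑ ν ∈ T, D * ((γ μ.1)⁻¹ * (γ μ.2)⁻¹ * (γ ν.1)⁻¹ * (γ ν.2)⁻¹ *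
            pairing A (prodFun φ μ) (prodFun φ ν) ^ 2) := by
          refine Finset.sum_le_sum fun μ hμ => Finset.sum_le_sum fun ν hν => ?_
          have hle := hw μ hμ ν hν
          have hμ' := Finset.sdiff_subset hμ
          simp only [T, Finset.mem_product] at hμ' hν
          have a1 := (hone _ hμ'.1).1
          have a2 := (hone _ hμ'.2).1
          have a3 := (hone _ hν.1).1
          have a4 := (hone _ hν.2).1
          rw [← mul_inv, ← mul_inv, ← mul_inv, ← mul_assoc, ← div_eq_mul_inv]
          refine le_mul_of_one_le_left (sq_nonneg _) ?_
          rwa [one_le_div (by positivity)]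
      _ ≤ ∑ μ ∈ T, ∑ ν ∈ T, D * ((γ μ.1)⁻¹ * (γ μ.2)⁻¹ * (γ ν.1)⁻¹ * (γ ν.2)⁻¹ *
            pairing A (prodFun φ μ) (prodFun φ ν) ^ 2) :=
          Finset.sum_le_sum_of_subset_of_nonneg Finset.sdiff_subset fun μ hμ _ =>
            Finset.sum_nonneg fun ν hν => mul_nonneg hD (hterm0 μ hμ ν hν)
      _ ≤ D * B ^ 2 := by
          simp only [← Finset.mul_sum]
          exact mul_le_mul_of_nonneg_left hR hD
  refine le_of_sq_le_sq ?_ (by positivity)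
  rw [hdiff, norm_sq_sum_smul_orthonormal hTS]
  calc ∑ μ ∈ T \ S, ⟪e μ, kernelCLM A x⟫_ℝ ^ 2
      ≤ ∑ μ ∈ T \ S, (∑ ν ∈ T, pairing A (prodFun φ μ) (prodFun φ ν) ^ 2) * ‖x‖ ^ 2 :=
        Finset.sum_le_sum fun μ _ => hcs μ
    _ ≤ D * B ^ 2 * ‖x‖ ^ 2 := by
        rw [← Finset.sum_mul]
        exact mul_le_mul_of_nonneg_right hsum (sq_nonneg _)
    _ = (c₂ ^ 2 * |B| * (n : ℝ) ^ (-α) * ‖x‖) ^ 2 := by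
        have : ((n : ℝ) ^ (-α)) ^ 2 = (n : ℝ) ^ (-2 * α) := by
          rw [← Real.rpow_natCast, ← Real.rpow_mul (by positivity)]
          congr 1; push_cast; ring
        rw [mul_pow, mul_pow, mul_pow, sq_abs, this]
        simp only [D]; ring

/-- The deterministic bound for the leading singular space of a perturbed covariance. -/
theorem opNorm_leadingProj_sub_le (hκ : 1 ≤ κ) {φ : ℕ → Fin κ → ℝ}
    (hφ : OrthonormalOn (Finset.Icc 1 κ) φ) {m l r : ℕ} {Shat Sig Phat : Pixel κ → Pixel κ → ℝ}
    {σ : ℕ → ℝ} {Φ : ℕ → Pixel κ → ℝ} (hSig : IsSpectral Sig r σ Φ)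
    (hP : IsLeadingProj (sandwich Shat (subspaceProj φ m) (subspaceProj φ l)) r Phat)
    {δ : ℝ} (hm : ∀ x, ‖kernelCLM Sig x - (gridSpan φ m).starProjection (kernelCLM Sig x)‖ ≤ δ * ‖x‖)
    (hl : ∀ x, ‖kernelCLM Sig x - (gridSpan φ l).starProjection (kernelCLM Sig x)‖
      ≤ σ r / 2 * ‖x‖) (hδ : 0 ≤ δ) :
    opNorm (fun x y => Phat x y - projKernel (Finset.Icc 1 r) Φ x y) ≤
      16 * (‖(gridSpan φ m).starProjection.comp
        ((kernelCLM Shat - kernelCLM Sig).comp (gridSpan φ l).starProjection)‖ + δ) / σ r := by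
  have : Nonempty (Fin κ) := ⟨⟨0, hκ⟩⟩
  obtain ⟨s, u, v, hsvd, rfl⟩ := hP
  have hrn : r ≤ Fintype.card (Pixel κ) := by simpa using hSig.orthonormal.card_le
  have hur : OrthonormalOn (Finset.Icc 1 r) u := by
    have hsub : ∀ k ∈ Finset.Icc 1 r, k ∈ Finset.Icc 1 (Fintype.card (Pixel κ)) := fun k hk =>
      Finset.Icc_subset_Icc le_rfl hrn hk
    exact ⟨fun j hj => hsvd.left_orthonormal.1 j (hsub j hj),
      fun j hj k hk => hsvd.left_orthonormal.2 j (hsub j hj) k (hsub k hk)⟩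
  refine (opNorm_le_norm_kernelCLM _).trans ?_
  rw [kernelCLM_sub, kernelCLM_projKernel hur, kernelCLM_projKernel hSig.orthonormal]
  set QM := (gridSpan φ m).starProjection
  set QL := (gridSpan φ l).starProjection
  refine (norm_leadingProjection_sub_le (u := fun k => toEuclid (u k)) (v := fun k => toEuclid (v k))
    (Φ := fun k => toEuclid (Φ k)) hrn (orthonormal_toEuclid hsvd.left_orthonormal)
    (orthonormal_toEuclid hsvd.right_orthonormal) hsvd.antitone hsvd.nonneg
    (orthonormal_toEuclid hSig.orthonormal) hSig.antitone hSig.pos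
    (kernelCLM_eq_sum hsvd.eq_sum) (kernelCLM_eq_sum hSig.eq_sum)
    (Q := QL) (fun x y => Submodule.inner_starProjection_left_eq_right _ _ _) hl).trans ?_
  have hσ := hSig.pos
  gcongr
  rw [kernelCLM_sandwich, kernelCLM_subspaceProj hκ hφ, kernelCLM_subspaceProj hκ hφ]
  have hadj : ContinuousLinearMap.adjoint QM = QM :=
    ((ContinuousLinearMap.eq_adjoint_iff _ _).2 fun x y =>
      Submodule.inner_starProjection_left_eq_right _ _ _).symm
  change ‖(ContinuousLinearMap.adjoint QM).comp ((kernelCLM Shat).comp QL) - _‖ ≤ _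
  rw [hadj]
  -- Fluctuation plus bias in `x` only: `Q_L` stands on the right of both compared operators, so no
  -- bias in `y` appears.
  have hsplit : QM.comp ((kernelCLM Shat).comp QL) - (kernelCLM Sig).comp QL
      = QM.comp ((kernelCLM Shat - kernelCLM Sig).comp QL)
        - (kernelCLM Sig - QM.comp (kernelCLM Sig)).comp QL := by
    ext1 x
    simp only [sub_apply, ContinuousLinearMap.comp_apply, map_sub]
    abel
  rw [hsplit]
  refine (norm_sub_le _ _).trans (add_le_add le_rfl ?_)
  refine ContinuousLinearMap.opNorm_le_bound _ hδ fun x => ?_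
  refine (hm (QL x)).trans ?_
  exact mul_le_mul_of_nonneg_left (Submodule.norm_starProjection_apply_le _ _) hδ

end Grid

/-! ### Nets and norms of compressions. -/

section Nets

open scoped InnerProductSpace

variable {E : Type*} [NormedAddCommGroup E] [InnerProductSpace ℝ E] [FiniteDimensional ℝ E]

variable (E) in
-- A maximal `1/2`-separated subset of the unit ball is a net. Doubled, it is `1`-separated in the
-- ball of radius `2`, and volume comparison bounds its size.
theorem exists_half_net : ∃ s : Finset E, s.card ≤ 5 ^ Module.finrank ℝ E ∧
    (∀ y ∈ s, ‖y‖ ≤ 1) ∧ ∀ x : E, ‖x‖ ≤ 1 → ∃ y ∈ s, ‖x - y‖ ≤ 1 / 2 := by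
  classical
  have hcard : ∀ s : Finset E, (∀ y ∈ s, ‖y‖ ≤ 1) →
      (∀ y ∈ s, ∀ z ∈ s, y ≠ z → 1 / 2 ≤ ‖y - z‖) → s.card ≤ 5 ^ Module.finrank ℝ E := by
    intro s h1 h2
    have hinj : Function.Injective (fun y : E => (2 : ℝ) • y) :=
      smul_right_injective E (two_ne_zero)
    rw [← Finset.card_image_of_injective s hinj]
    apply Besicovitch.card_le_of_separated
    · intro c hc
      obtain ⟨y, hy, rfl⟩ := Finset.mem_image.1 hc
      have := h1 y hy
      rw [norm_smul, Real.norm_two]; linarith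
    · intro c hc d hd hcd
      obtain ⟨y, hy, rfl⟩ := Finset.mem_image.1 hc
      obtain ⟨z, hz, rfl⟩ := Finset.mem_image.1 hd
      have := h2 y hy z hz fun e => hcd (by rw [e])
      rw [← smul_sub, norm_smul, Real.norm_two]; linarith
  by_contra hno
  push Not at hno
  -- Without a small net, any separated set could be enlarged by one more point, eventually beyond
  -- the volume bound.
  have hall : ∀ k : ℕ, ∃ s : Finset E, s.card = k ∧ (∀ y ∈ s, ‖y‖ ≤ 1) ∧
      ∀ y ∈ s, ∀ z ∈ s, y ≠ z → 1 / 2 ≤ ‖y - z‖ := by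
    intro k
    induction k with
    | zero => exact ⟨∅, by simp⟩
    | succ k ih =>
      obtain ⟨s, hs, h1, h2⟩ := ih
      obtain ⟨x, hx, hxs⟩ := hno s (hcard s h1 h2) h1
      have hmem : x ∉ s := fun h => by
        have := hxs x h
        norm_num at this
      refine ⟨insert x s, by rw [Finset.card_insert_of_notMem hmem, hs], ?_, ?_⟩
      · intro y hy
        rcases Finset.mem_insert.1 hy with rfl | hy
        · exact hx
        · exact h1 y hy
      · intro y hy z hz hyz
        rcases Finset.mem_insert.1 hy with h3 | h3 <;> rcases Finset.mem_insert.1 hz with h4 | h4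
        · exact absurd (h3.trans h4.symm) hyz
        · rw [h3]; exact (hxs z h4).le
        · rw [h4, norm_sub_rev]; exact (hxs y h3).le
        · exact h2 y h3 z h4 hyz
  obtain ⟨s, hs, h1, h2⟩ := hall (5 ^ Module.finrank ℝ E + 1)
  have := hcard s h1 h2
  omega

/-- A finite set of test vectors for the norm of a projection. -/
theorem exists_net_norm_starProjection_le (M : Submodule ℝ E) :
    ∃ s : Finset E, s.card ≤ 5 ^ Module.finrank ℝ M ∧ (∀ y ∈ s, ‖y‖ ≤ 1) ∧
      ∀ (x : E) (t : ℝ), 0 ≤ t → (∀ y ∈ s, ⟪y, x⟫_ℝ ≤ t) → ‖M.starProjection x‖ ≤ 2 * t := by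
  classical
  obtain ⟨s, hs, h1, h2⟩ := exists_half_net M
  refine ⟨s.image Subtype.val, Finset.card_image_le.trans hs, ?_, ?_⟩
  · intro y hy
    obtain ⟨z, hz, rfl⟩ := Finset.mem_image.1 hy
    exact h1 z hz
  intro x t ht hx
  set z := M.starProjection x
  have hzM : z ∈ M := Submodule.starProjection_apply_mem _ _
  rcases (norm_nonneg z).eq_or_lt with h0 | h0
  · rw [← h0]; positivity
  -- With `y` in the net within `1/2` of the unit vector `w` along `z`: `‖z‖ = ⟪w, z⟫ ≤ ⟪y, z⟫ + ‖z‖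
  -- / 2`.
  set w : M := ⟨‖z‖⁻¹ • z, M.smul_mem _ hzM⟩
  have hw : ‖w‖ ≤ 1 := by
    change ‖‖z‖⁻¹ • z‖ ≤ 1
    rw [norm_smul, norm_inv, norm_norm, inv_mul_cancel₀ h0.ne']
  obtain ⟨y, hy, hwy⟩ := h2 w hw
  have e1 : ∀ v : M, ⟪(v : E), x⟫_ℝ = ⟪(v : E), z⟫_ℝ := by
    intro v
    rw [← Submodule.inner_starProjection_left_eq_right,
      Submodule.starProjection_eq_self_iff.2 v.2]
  have e2 : ⟪(w : E), z⟫_ℝ = ‖z‖ := by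
    change ⟪‖z‖⁻¹ • z, z⟫_ℝ = ‖z‖
    rw [inner_smul_left, real_inner_self_eq_norm_sq]
    simp only [conj_trivial]
    field_simp
  have e3 : ⟪((w - y : M) : E), z⟫_ℝ ≤ 1 / 2 * ‖z‖ :=
    (real_inner_le_norm _ _).trans (mul_le_mul_of_nonneg_right hwy h0.le)
  have e4 := hx y (Finset.mem_image_of_mem _ hy)
  rw [e1] at e4
  rw [Submodule.coe_sub, inner_sub_left, e2] at e3
  linarith

/-- The norm of a compression is controlled by the values of the form on two nets. -/
theorem exists_nets_norm_comp_le (M L : Submodule ℝ E) :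
    ∃ s s' : Finset E, s.card ≤ 5 ^ Module.finrank ℝ M ∧ s'.card ≤ 5 ^ Module.finrank ℝ L ∧
      (∀ y ∈ s, ‖y‖ ≤ 1) ∧ (∀ y ∈ s', ‖y‖ ≤ 1) ∧
      ∀ (A : E →L[ℝ] E) (t : ℝ), 0 ≤ t → (∀ y ∈ s, ∀ z ∈ s', ⟪y, A z⟫_ℝ ≤ t) →
        ‖M.starProjection.comp (A.comp L.starProjection)‖ ≤ 4 * t := by
  obtain ⟨s, hs, h1, h2⟩ := exists_net_norm_starProjection_le M
  obtain ⟨s', hs', h1', h2'⟩ := exists_net_norm_starProjection_le L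
  refine ⟨s, s', hs, hs', h1, h1', fun A t ht hA => ?_⟩
  -- The one-sided net bound is used twice, first on `L` for `A* y` with `y` fixed in the net, then
  -- on `M`; each use costs a factor `2`.
  have hstep : ∀ y ∈ s, ‖L.starProjection (ContinuousLinearMap.adjoint A y)‖ ≤ 2 * t := by
    intro y hy
    refine h2' _ t ht fun z hz => ?_
    rw [ContinuousLinearMap.adjoint_inner_right, real_inner_comm]
    exact hA y hy z hz
  refine ContinuousLinearMap.opNorm_le_bound _ (by positivity) fun x => ?_
  have := h2 (A (L.starProjection x)) (2 * t * ‖x‖) (by positivity) fun y hy => by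
    rw [← ContinuousLinearMap.adjoint_inner_left, ← Submodule.inner_starProjection_left_eq_right]
    exact (real_inner_le_norm _ _).trans (mul_le_mul_of_nonneg_right (hstep y hy) (norm_nonneg x))
  simp only [ContinuousLinearMap.comp_apply]
  linarith

end Nets

/-! ### Exponential moments and Bernstein's inequality. -/

section SubExponential

variable {Ω : Type*} [MeasurableSpace Ω] {P : Measure Ω}

/-- The exact value is `√2`. -/
theorem lintegral_exp_sq_div_four_gaussianReal :
    ∫⁻ g, ENNReal.ofReal (Real.exp (g ^ 2 / 4)) ∂(gaussianReal 0 1) ≤ 2 := by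
  rw [gaussianReal_of_var_ne_zero 0 one_ne_zero,
    lintegral_withDensity_eq_lintegral_mul _ (measurable_gaussianPDF 0 1) (by fun_prop)]
  have hcongr : ∀ g : ℝ, (gaussianPDF 0 1 * fun g => ENNReal.ofReal (Real.exp (g ^ 2 / 4))) g
      = ENNReal.ofReal ((Real.sqrt (2 * Real.pi))⁻¹ * Real.exp (-(1 / 4) * g ^ 2)) := by
    intro g
    rw [Pi.mul_apply, gaussianPDF, ← ENNReal.ofReal_mul (gaussianPDFReal_nonneg 0 1 g),
      gaussianPDFReal, mul_assoc, ← Real.exp_add]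
    congr 3
    · simp
    · simp; ring
  simp_rw [hcongr]
  rw [← ofReal_integral_eq_lintegral_ofReal
    ((integrable_exp_neg_mul_sq (by norm_num : (0 : ℝ) < 1 / 4)).const_mul _)
    (ae_of_all _ fun g => by positivity), integral_const_mul, integral_gaussian]
  rw [show (2 : ℝ≥0∞) = ENNReal.ofReal 2 by simp]
  apply ENNReal.ofReal_le_ofReal
  rw [← Real.sqrt_inv, ← Real.sqrt_mul (by positivity)]
  rw [Real.sqrt_le_left (by norm_num)]
  have := Real.pi_pos
  field_simp
  norm_num

theorem hasSubgaussianMGF_mono {X : Ω → ℝ} {c c' : ℝ≥0} (h : HasSubgaussianMGF X c P)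
    (hc : c ≤ c') : HasSubgaussianMGF X c' P where
  integrable_exp_mul := h.integrable_exp_mul
  mgf_le t := (h.mgf_le t).trans (Real.exp_le_exp.2 (by gcongr))

/-- Gaussian linearisation: `exp (x² / (4c))` is the mean of `exp (t x g)` over a standard Gaussian
`g` when `t² = 1 / (2c)`. After exchanging the integrals, the sub-Gaussian bound leaves the mean of
`exp (g² / 4)`. -/
theorem lintegral_exp_sq_le [IsProbabilityMeasure P] {X : Ω → ℝ} (hXm : Measurable X) {c : ℝ≥0}
    (hc : 0 < c) (hX : HasSubgaussianMGF X c P) :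
    ∫⁻ ω, ENNReal.ofReal (Real.exp (1 / (4 * c) * X ω ^ 2)) ∂P ≤ 2 := by
  have hc' : (0 : ℝ) < c := hc
  set t : ℝ := Real.sqrt (1 / (2 * c))
  have ht : t ^ 2 = 1 / (2 * c) := Real.sq_sqrt (by positivity)
  have h1 : ∀ x : ℝ, ENNReal.ofReal (Real.exp (1 / (4 * c) * x ^ 2))
      = ∫⁻ g, ENNReal.ofReal (Real.exp ((t * x) * g)) ∂(gaussianReal 0 1) := by
    intro x
    rw [← ofReal_integral_eq_lintegral_ofReal (integrable_exp_mul_gaussianReal (t * x))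
      (ae_of_all _ fun g => by positivity)]
    have := congrFun (mgf_id_gaussianReal (μ := 0) (v := 1)) (t * x)
    simp only [mgf, id] at this
    rw [this, mul_pow, ht]
    congr 2
    push_cast
    field_simp
    ring
  simp_rw [h1]
  rw [lintegral_lintegral_swap (by fun_prop)]
  refine le_trans (lintegral_mono fun g => ?_) lintegral_exp_sq_div_four_gaussianReal
  have h2 : ∀ ω, t * X ω * g = (t * g) * X ω := fun ω => by ring
  simp_rw [h2]
  rw [← ofReal_integral_eq_lintegral_ofReal (hX.integrable_exp_mul _)
    (ae_of_all _ fun g => by positivity)]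
  apply ENNReal.ofReal_le_ofReal
  refine (hX.mgf_le (t * g)).trans (le_of_eq ?_)
  rw [mul_pow, ht]
  congr 1
  field_simp
  ring

theorem integrable_exp_sq [IsProbabilityMeasure P] {X : Ω → ℝ} (hXm : Measurable X) {c : ℝ≥0}
    (hc : 0 < c) (hX : HasSubgaussianMGF X c P) :
    Integrable (fun ω => Real.exp (1 / (4 * c) * X ω ^ 2)) P ∧
      ∫ ω, Real.exp (1 / (4 * c) * X ω ^ 2) ∂P ≤ 2 := by
  have h := lintegral_exp_sq_le hXm hc hX
  have hi : Integrable (fun ω => Real.exp (1 / (4 * c) * X ω ^ 2)) P := by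
    refine ⟨by fun_prop, ?_⟩
    rw [hasFiniteIntegral_iff_ofReal (ae_of_all _ fun g => by positivity)]
    exact lt_of_le_of_lt h (by simp)
  refine ⟨hi, ?_⟩
  rw [← ofReal_integral_eq_lintegral_ofReal hi (ae_of_all _ fun g => by positivity)] at h
  rw [show (2 : ℝ≥0∞) = ENNReal.ofReal 2 by simp] at h
  exact (ENNReal.ofReal_le_ofReal_iff (by norm_num)).1 h

/-- `Z` has an exponential moment of order `a` bounded by `2`. -/
structure HasExpMoment (Z : Ω → ℝ) (a : ℝ) (P : Measure Ω) : Prop where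
  measurable : Measurable Z
  integrable : Integrable (fun ω => Real.exp (a * |Z ω|)) P
  integral_le : ∫ ω, Real.exp (a * |Z ω|) ∂P ≤ 2

/-- From `|XY| ≤ (X² + Y²) / 2` and the convexity of `exp`, the moment of the product is at most the
average of the two square-exponential moments. No independence of `X` and `Y` is needed. -/
theorem hasExpMoment_mul [IsProbabilityMeasure P] {X Y : Ω → ℝ} (hXm : Measurable X)
    (hYm : Measurable Y) {c : ℝ≥0} (hc : 0 < c) (hX : HasSubgaussianMGF X c P)
    (hY : HasSubgaussianMGF Y c P) :
    HasExpMoment (fun ω => X ω * Y ω) (1 / (4 * c)) P := by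
  obtain ⟨hX1, hX2⟩ := integrable_exp_sq hXm hc hX
  obtain ⟨hY1, hY2⟩ := integrable_exp_sq hYm hc hY
  have hpt : ∀ ω, Real.exp (1 / (4 * c) * |X ω * Y ω|)
      ≤ (Real.exp (1 / (4 * c) * X ω ^ 2) + Real.exp (1 / (4 * c) * Y ω ^ 2)) / 2 := by
    intro ω
    have ha : (0 : ℝ) ≤ 1 / (4 * c) := by positivity
    have h1 : |X ω * Y ω| ≤ (X ω ^ 2 + Y ω ^ 2) / 2 := by
      rw [abs_mul, ← sq_abs (X ω), ← sq_abs (Y ω)]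
      nlinarith [sq_nonneg (|X ω| - |Y ω|)]
    set p := 1 / (4 * (c : ℝ)) * X ω ^ 2
    set q := 1 / (4 * (c : ℝ)) * Y ω ^ 2
    have h2 : 1 / (4 * (c : ℝ)) * |X ω * Y ω| ≤ p / 2 + q / 2 := by
      refine (mul_le_mul_of_nonneg_left h1 ha).trans (le_of_eq ?_)
      simp only [p, q]; ring
    refine (Real.exp_le_exp.2 h2).trans ?_
    have e1 : Real.exp p = Real.exp (p / 2) ^ 2 := by rw [← Real.exp_nat_mul]; congr 1; push_cast; ring
    have e2 : Real.exp q = Real.exp (q / 2) ^ 2 := by rw [← Real.exp_nat_mul]; congr 1; push_cast; ring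
    rw [Real.exp_add, e1, e2]
    nlinarith [sq_nonneg (Real.exp (p / 2) - Real.exp (q / 2))]
  have hi : Integrable (fun ω => (Real.exp (1 / (4 * c) * X ω ^ 2) +
      Real.exp (1 / (4 * c) * Y ω ^ 2)) / 2) P := (hX1.add hY1).div_const 2
  have hZ : Integrable (fun ω => Real.exp (1 / (4 * c) * |X ω * Y ω|)) P := by
    refine hi.mono' (by fun_prop) (ae_of_all _ fun ω => ?_)
    rw [Real.norm_eq_abs, abs_of_pos (Real.exp_pos _)]
    exact hpt ω
  refine ⟨hXm.mul hYm, hZ, (integral_mono hZ hi hpt).trans ?_⟩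
  rw [integral_div, integral_add hX1 hY1]
  linarith

theorem exp_le_one_add_self_add_sq_mul_exp_abs (x : ℝ) :
    Real.exp x ≤ 1 + x + x ^ 2 * Real.exp |x| := by
  have he : 1 ≤ Real.exp |x| := Real.one_le_exp (abs_nonneg x)
  rcases le_or_gt |x| 1 with h | h
  · have h1 := Real.abs_exp_sub_one_sub_id_le h
    have h2 := (abs_le.1 h1).2
    nlinarith [sq_nonneg x]
  · rcases lt_or_ge x 0 with h0 | h0
    · rw [abs_of_neg h0] at h he
      have h3 : Real.exp x ≤ 1 := Real.exp_le_one_iff.2 h0.le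
      rw [abs_of_neg h0]
      nlinarith [sq_nonneg x]
    · rw [abs_of_nonneg h0] at h ⊢
      have h2 : 1 ≤ x ^ 2 := by nlinarith
      nlinarith [mul_le_mul_of_nonneg_right h2 (Real.exp_pos x).le]

namespace HasExpMoment

variable {Z : Ω → ℝ} {a : ℝ}

theorem integrable_self (h : HasExpMoment Z a P) (ha : 0 < a) : Integrable Z P := by
  refine (h.integrable.const_mul a⁻¹).mono' h.measurable.aestronglyMeasurable
    (ae_of_all _ fun ω => ?_)
  rw [Real.norm_eq_abs, inv_mul_eq_div, le_div_iff₀ ha]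
  linarith [Real.add_one_le_exp (a * |Z ω|)]

theorem neg (h : HasExpMoment Z a P) : HasExpMoment (fun ω => -Z ω) a P := by
  refine ⟨h.measurable.neg, ?_, ?_⟩ <;> simp only [abs_neg]
  exacts [h.integrable, h.integral_le]

theorem abs_integral_le (h : HasExpMoment Z a P) (ha : 0 < a) : |∫ ω, Z ω ∂P| ≤ 2 / a := by
  refine abs_integral_le_integral_abs.trans ?_
  have h1 : ∫ ω, |Z ω| ∂P ≤ ∫ ω, a⁻¹ * Real.exp (a * |Z ω|) ∂P := by
    refine integral_mono (h.integrable_self ha).abs (h.integrable.const_mul a⁻¹) fun ω => ?_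
    simp only
    rw [inv_mul_eq_div, le_div_iff₀ ha]
    linarith [Real.add_one_le_exp (a * |Z ω|)]
  refine h1.trans ?_
  rw [integral_const_mul, inv_mul_eq_div]
  exact div_le_div_of_nonneg_right h.integral_le ha.le

variable [IsProbabilityMeasure P]

/-- Centring makes the linear term of `exp (t z)` vanish. For `|t| ≤ a / 2` the quadratic remainder
is at most `(8 t² / a²) exp (a |z|)`, and the mean of `exp (a |z|)` is at most `2 e² ≤ 16`, whence
`128`. -/
theorem mgf_sub_integral_le (h : HasExpMoment Z a P) (ha : 0 < a) {t : ℝ} (ht : |t| ≤ a / 2) :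
    Integrable (fun ω => Real.exp (t * (Z ω - ∫ ω', Z ω' ∂P))) P ∧
      mgf (fun ω => Z ω - ∫ ω', Z ω' ∂P) P t ≤ Real.exp (128 / a ^ 2 * t ^ 2) := by
  set μ := ∫ ω', Z ω' ∂P
  have hμ : a * |μ| ≤ 2 := by
    have := h.abs_integral_le ha
    rw [le_div_iff₀ ha] at this
    linarith
  have hm := h.measurable
  have hE : ∀ ω, Real.exp (a * |Z ω - μ|) ≤ Real.exp 2 * Real.exp (a * |Z ω|) := by
    intro ω
    rw [← Real.exp_add]
    apply Real.exp_le_exp.2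
    have : |Z ω - μ| ≤ |Z ω| + |μ| := abs_sub _ _
    nlinarith
  have hi' : Integrable (fun ω => Real.exp (a * |Z ω - μ|)) P := by
    refine (h.integrable.const_mul (Real.exp 2)).mono' (by fun_prop) (ae_of_all _ fun ω => ?_)
    rw [Real.norm_eq_abs, abs_of_pos (Real.exp_pos _)]
    exact hE ω
  have hI : ∫ ω, Real.exp (a * |Z ω - μ|) ∂P ≤ 16 := by
    refine (integral_mono hi' (h.integrable.const_mul (Real.exp 2)) hE).trans ?_
    rw [integral_const_mul]
    have he : Real.exp 2 ≤ 8 := by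
      have : Real.exp 2 = Real.exp 1 ^ 2 := by rw [← Real.exp_nat_mul]; norm_num
      rw [this]
      have := Real.exp_one_lt_d9
      nlinarith [Real.exp_pos 1]
    have := h.integral_le
    have h0 : 0 ≤ ∫ ω, Real.exp (a * |Z ω|) ∂P := integral_nonneg fun _ => (Real.exp_pos _).le
    nlinarith
  have hpt : ∀ ω, Real.exp (t * (Z ω - μ))
      ≤ 1 + t * (Z ω - μ) + 8 / a ^ 2 * t ^ 2 * Real.exp (a * |Z ω - μ|) := by
    intro ω
    set z := Z ω - μ
    refine (exp_le_one_add_self_add_sq_mul_exp_abs (t * z)).trans ?_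
    have h1 : |t * z| ≤ a / 2 * |z| := by
      rw [abs_mul]; exact mul_le_mul_of_nonneg_right ht (abs_nonneg z)
    have h2 : (a / 2 * |z|) ^ 2 ≤ 2 * Real.exp (a / 2 * |z|) := by
      have := Real.quadratic_le_exp_of_nonneg (by positivity : 0 ≤ a / 2 * |z|)
      have : 0 ≤ a / 2 * |z| := by positivity
      linarith
    have h3 : Real.exp |t * z| ≤ Real.exp (a / 2 * |z|) := Real.exp_le_exp.2 h1
    have h4 : Real.exp (a * |z|) = Real.exp (a / 2 * |z|) * Real.exp (a / 2 * |z|) := by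
      rw [← Real.exp_add]; congr 1; ring
    have h5 : (t * z) ^ 2 = 4 / a ^ 2 * t ^ 2 * (a / 2 * |z|) ^ 2 := by
      rw [mul_pow, mul_pow, sq_abs]; field_simp; ring
    have h6 : (t * z) ^ 2 * Real.exp |t * z|
        ≤ (4 / a ^ 2 * t ^ 2 * (2 * Real.exp (a / 2 * |z|))) * Real.exp (a / 2 * |z|) := by
      rw [h5]
      exact mul_le_mul (mul_le_mul_of_nonneg_left h2 (by positivity)) h3 (Real.exp_pos _).le
        (by positivity)
    rw [h4]
    calc _ ≤ 1 + t * z + (4 / a ^ 2 * t ^ 2 * (2 * Real.exp (a / 2 * |z|))) *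
          Real.exp (a / 2 * |z|) := by linarith
      _ = _ := by ring
  have hZi : Integrable (fun ω => Z ω - μ) P := (h.integrable_self ha).sub (integrable_const μ)
  have h1i : Integrable (fun ω => 1 + t * (Z ω - μ)) P :=
    (integrable_const 1).add (hZi.const_mul t)
  have hbi : Integrable (fun ω => 1 + t * (Z ω - μ) +
      8 / a ^ 2 * t ^ 2 * Real.exp (a * |Z ω - μ|)) P :=
    h1i.add (hi'.const_mul _)
  have hti : Integrable (fun ω => Real.exp (t * (Z ω - μ))) P := by
    refine hi'.mono' (by fun_prop) (ae_of_all _ fun ω => ?_)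
    rw [Real.norm_eq_abs, abs_of_pos (Real.exp_pos _)]
    apply Real.exp_le_exp.2
    refine (le_abs_self _).trans ?_
    rw [abs_mul]
    exact mul_le_mul_of_nonneg_right (by linarith) (abs_nonneg _)
  refine ⟨hti, ?_⟩
  refine (integral_mono hti hbi hpt).trans ?_
  rw [integral_add h1i (hi'.const_mul _),
    integral_add (integrable_const 1) (hZi.const_mul t), integral_const_mul, integral_const_mul,
    integral_sub (h.integrable_self ha) (integrable_const μ)]
  simp only [integral_const, probReal_univ, smul_eq_mul, mul_one, one_mul]
  have h7 : 8 / a ^ 2 * t ^ 2 * ∫ ω, Real.exp (a * |Z ω - μ|) ∂P ≤ 128 / a ^ 2 * t ^ 2 := by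
    refine (mul_le_mul_of_nonneg_left hI (by positivity)).trans (le_of_eq ?_)
    ring
  have h8 := Real.add_one_le_exp (128 / a ^ 2 * t ^ 2)
  have h9 : (∫ ω, Z ω ∂P) - μ = 0 := sub_self _
  rw [h9]
  linarith

theorem integral_mul_self_le {X : Ω → ℝ} (hXm : Measurable X) {c : ℝ≥0} (hc : 0 < c)
    (hX : HasSubgaussianMGF X c P) : ∫ ω, X ω * X ω ∂P ≤ 8 * c := by
  have hc' : (0 : ℝ) < c := hc
  have h := (hasExpMoment_mul hXm hXm hc hX hX).abs_integral_le (by positivity)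
  refine (le_abs_self _).trans (h.trans (le_of_eq ?_))
  field_simp
  norm_num

/-- Bernstein's inequality for independent variables with a common exponential moment. -/
theorem measure_sum_ge_le {N : ℕ} {Z : Fin N → Ω → ℝ} (hZ : ∀ i, HasExpMoment (Z i) a P)
    (ha : 0 < a) (hind : iIndepFun Z P) {t : ℝ} (ht0 : 0 ≤ t) (ht : t ≤ 128 / a) :
    P.real {ω | N * t ≤ ∑ i, (Z i ω - ∫ ω', Z i ω' ∂P)} ≤ Real.exp (-(N * (a ^ 2 * t ^ 2 / 512))) := by
  -- The minimiser of `128 λ² / a² - λ t`; the assumption `t ≤ 128 / a` is exactly `λ ≤ a / 2`.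
  set lam := a ^ 2 * t / 256
  have hlam : |lam| ≤ a / 2 := by
    rw [abs_of_nonneg (by positivity)]
    rw [le_div_iff₀ ha] at ht
    simp only [lam]
    nlinarith
  set Y : Fin N → Ω → ℝ := fun i ω => Z i ω - ∫ ω', Z i ω' ∂P
  have hYm : ∀ i, Measurable (Y i) := fun i => (hZ i).measurable.sub_const _
  have hY : iIndepFun Y P := hind.comp (fun i x => x - ∫ ω', Z i ω' ∂P) fun i => by fun_prop
  have hi : Integrable (fun ω => Real.exp (lam * (∑ i, Y i) ω)) P :=
    hY.integrable_exp_mul_sum hYm fun i _ => ((hZ i).mgf_sub_integral_le ha hlam).1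
  have h1 := measure_ge_le_exp_mul_mgf (N * t) (by positivity : 0 ≤ lam) hi
  have hset : {ω | N * t ≤ ∑ i, (Z i ω - ∫ ω', Z i ω' ∂P)} = {ω | N * t ≤ (∑ i, Y i) ω} := by
    ext ω; simp [Y]
  rw [hset]
  refine h1.trans ?_
  rw [hY.mgf_sum hYm]
  have h2 : ∏ i, mgf (Y i) P lam ≤ ∏ _i : Fin N, Real.exp (128 / a ^ 2 * lam ^ 2) :=
    Finset.prod_le_prod (fun i _ => mgf_nonneg) fun i _ => ((hZ i).mgf_sub_integral_le ha hlam).2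
  rw [Finset.prod_const, Finset.card_univ, Fintype.card_fin, ← Real.exp_nat_mul] at h2
  refine (mul_le_mul_of_nonneg_left h2 (Real.exp_pos _).le).trans ?_
  rw [← Real.exp_add]
  apply Real.exp_le_exp.2
  apply le_of_eq
  simp only [lam]
  field_simp
  ring

theorem measure_abs_sum_ge_le {N : ℕ} {Z : Fin N → Ω → ℝ} (hZ : ∀ i, HasExpMoment (Z i) a P)
    (ha : 0 < a) (hind : iIndepFun Z P) {t : ℝ} (ht0 : 0 ≤ t) (ht : t ≤ 128 / a) :
    P.real {ω | N * t ≤ |∑ i, (Z i ω - ∫ ω', Z i ω' ∂P)|}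
      ≤ 2 * Real.exp (-(N * (a ^ 2 * t ^ 2 / 512))) := by
  have h1 := measure_sum_ge_le hZ ha hind ht0 ht
  have h2 := measure_sum_ge_le (fun i => (hZ i).neg) ha
    (hind.comp (fun _ x => -x) fun i => by fun_prop) ht0 ht
  have hsub : {ω | N * t ≤ |∑ i, (Z i ω - ∫ ω', Z i ω' ∂P)|} ⊆
      {ω | N * t ≤ ∑ i, (Z i ω - ∫ ω', Z i ω' ∂P)} ∪
      {ω | N * t ≤ ∑ i, (-Z i ω - ∫ ω', -Z i ω' ∂P)} := by
    intro ω hω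
    rcases le_abs.1 (show N * t ≤ |∑ i, (Z i ω - ∫ ω', Z i ω' ∂P)| from hω) with h | h
    · exact Or.inl h
    · right
      refine le_trans h (le_of_eq ?_)
      rw [← Finset.sum_neg_distrib]
      refine Finset.sum_congr rfl fun i _ => ?_
      rw [integral_neg]; ring
  refine (measureReal_mono hsub).trans ((measureReal_union_le _ _).trans ?_)
  have h3 : P.real {ω | N * t ≤ ∑ i, (-Z i ω - ∫ ω', -Z i ω' ∂P)}
    ≤ Real.exp (-(N * (a ^ 2 * t ^ 2 / 512))) := h2
  linarith

end HasExpMoment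

/-- Two-sided tail bound for the sum of independent sub-Gaussian variables. -/
theorem measure_abs_sum_subgaussian_ge_le [IsProbabilityMeasure P] {N : ℕ} {X : Fin N → Ω → ℝ}
    {c : ℝ≥0} (hc : 0 < c) (hX : ∀ i, HasSubgaussianMGF (X i) c P) (hind : iIndepFun X P) {t : ℝ}
    (ht : 0 ≤ t) :
    P.real {ω | N * t ≤ |∑ i, X i ω|} ≤ 2 * Real.exp (-(N * (t ^ 2 / (2 * c)))) := by
  have hc' : (0 : ℝ) < c := hc
  have hexp : Real.exp (-(N * t) ^ 2 / (2 * ((∑ _i : Fin N, c : ℝ≥0) : ℝ)))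
      ≤ Real.exp (-(N * (t ^ 2 / (2 * c)))) := by
    apply Real.exp_le_exp.2
    apply le_of_eq
    rcases Nat.eq_zero_or_pos N with h | h
    · subst h; simp
    · have : (0 : ℝ) < N := by exact_mod_cast h
      simp
      field_simp
  have h1 := (HasSubgaussianMGF.measure_sum_ge_le_of_iIndepFun hind (c := fun _ => c)
    (s := Finset.univ) (fun i _ => hX i) (by positivity : (0 : ℝ) ≤ N * t)).trans hexp
  have h2 := (HasSubgaussianMGF.measure_sum_ge_le_of_iIndepFun
    (hind.comp (fun _ x => -x) fun i => by fun_prop) (c := fun _ => c)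
    (s := Finset.univ) (fun i _ => (hX i).neg) (by positivity : (0 : ℝ) ≤ N * t)).trans hexp
  have hsub : {ω | N * t ≤ |∑ i, X i ω|} ⊆ {ω | N * t ≤ ∑ i, X i ω} ∪ {ω | N * t ≤ ∑ i, -X i ω} := by
    intro ω hω
    rcases le_abs.1 (show N * t ≤ |∑ i, X i ω| from hω) with h | h
    · exact Or.inl h
    · right
      refine le_trans h (le_of_eq ?_)
      rw [← Finset.sum_neg_distrib]
  refine (measureReal_mono hsub).trans ((measureReal_union_le _ _).trans ?_)
  have h3 : P.real {ω | N * t ≤ ∑ i, -X i ω} ≤ Real.exp (-(N * (t ^ 2 / (2 * c)))) := h2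
  linarith

end SubExponential

/-! ### Independence of grouped and paired families. -/

section Independence

variable {Ω ι : Type*} [MeasurableSpace Ω] {P : Measure Ω}

/-- Having `univ` in each system allows the sets to be prescribed at all indices, including those
outside `S`. -/
theorem iIndepFun_of_isPiSystem {β : ι → Type*} {mβ : ∀ i, MeasurableSpace (β i)}
    {h : ∀ i, Ω → β i} (hm : ∀ i, Measurable (h i)) (C : ∀ i, Set (Set (β i)))
    (hC : ∀ i, IsPiSystem (C i)) (hgen : ∀ i, mβ i =
      MeasurableSpace.generateFrom (C i)) (huniv : ∀ i, Set.univ ∈ C i)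
    (hind : ∀ (S : Finset ι) (s : ∀ i, Set (β i)), (∀ i, s i ∈ C i) →
      P (⋂ i ∈ S, h i ⁻¹' s i) = ∏ i ∈ S, P (h i ⁻¹' s i)) : iIndepFun h P := by
  classical
  rw [iIndepFun_iff_iIndep]
  refine iIndepSets.iIndep (fun i => (hm i).comap_le) (fun i => {t | ∃ s ∈ C i, h i ⁻¹' s = t})
    (fun i => (hC i).comap (h i)) (fun i => ?_) ?_
  · conv_lhs => rw [hgen i]
    rw [MeasurableSpace.comap_generateFrom]
    rfl
  · rw [iIndepSets_iff]
    intro S f hf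
    have : ∀ i, ∃ s ∈ C i, i ∈ S → h i ⁻¹' s = f i := fun i => by
      by_cases hi : i ∈ S
      · obtain ⟨s, hs, e⟩ := hf i hi
        exact ⟨s, hs, fun _ => e⟩
      · exact ⟨Set.univ, huniv i, fun h => absurd h hi⟩
    choose s hs he using this
    have h1 := hind S s hs
    rw [Finset.prod_congr rfl fun i hi => by rw [he i hi]] at h1
    rw [← h1]
    congr 1
    exact Set.iInter₂_congr fun i hi => (he i hi).symm

/-- Boxes form a generating π-system of the product, and on boxes both sides are the same double
product. -/
theorem iIndepFun.curry {κ γ : Type*} [Fintype κ] [MeasurableSpace γ] {g : ι × κ → Ω → γ}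
    (hm : ∀ p, Measurable (g p)) (hg : iIndepFun g P) :
    iIndepFun (fun (i : ι) ω (x : κ) => g (i, x) ω) P := by
  classical
  have hprob := hg.isProbabilityMeasure
  refine iIndepFun_of_isPiSystem (fun i => by fun_prop)
    (fun _ => Set.pi Set.univ '' Set.pi Set.univ fun _ => {s : Set γ | MeasurableSet s})
    (fun _ => isPiSystem_pi) (fun _ => generateFrom_pi.symm) (fun _ => ?_) fun S s hs => ?_
  · exact ⟨fun _ => Set.univ, fun _ _ => MeasurableSet.univ, by simp⟩
  choose b hb he using hs
  have hpre : ∀ i, (fun ω (x : κ) => g (i, x) ω) ⁻¹' s i = ⋂ x, g (i, x) ⁻¹' b i x := by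
    intro i
    rw [← he i]
    ext ω
    simp [Set.mem_pi]
  have hfull : ∀ S : Finset ι, P (⋂ i ∈ S, ⋂ x, g (i, x) ⁻¹' b i x)
      = ∏ i ∈ S, ∏ x, P (g (i, x) ⁻¹' b i x) := by
    intro S
    have := hg.measure_inter_preimage_eq_mul (S ×ˢ (Finset.univ : Finset κ))
      (sets := fun p => b p.1 p.2) (fun p _ => hb p.1 p.2 (Set.mem_univ _))
    rw [Finset.prod_product] at this
    rw [← this]
    congr 1
    ext ω
    simp only [Set.mem_iInter, Finset.mem_product, Finset.mem_univ, and_true, Prod.forall]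
    exact ⟨fun h i x hi => h i hi x, fun h i hi x => h i x hi⟩
  simp_rw [hpre]
  rw [hfull]
  refine Finset.prod_congr rfl fun i _ => ?_
  simpa using (hfull {i}).symm

/-- On rectangles the event splits into an `f`-part and a `g`-part. These are independent as blocks,
and each factorises over the indices. -/
theorem iIndepFun.prodMk {β γ : Type*} [MeasurableSpace β] [MeasurableSpace γ] {f : ι → Ω → β}
    {g : ι → Ω → γ} (hfm : ∀ i, Measurable (f i)) (hgm : ∀ i, Measurable (g i))
    (hf : iIndepFun f P) (hg : iIndepFun g P)
    (hfg : IndepFun (fun ω i => f i ω) (fun ω i => g i ω) P) :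
    iIndepFun (fun i ω => (f i ω, g i ω)) P := by
  refine iIndepFun_of_isPiSystem (fun i => by fun_prop)
    (fun _ => Set.image2 (· ×ˢ ·) {s : Set β | MeasurableSet s} {t : Set γ | MeasurableSet t})
    (fun _ => isPiSystem_prod) (fun _ => generateFrom_prod.symm) (fun _ => ?_) fun S s hs => ?_
  · exact ⟨Set.univ, MeasurableSet.univ, Set.univ, MeasurableSet.univ, by simp⟩
  choose a ha b hb he using hs
  have hpre : ∀ i, (fun ω => (f i ω, g i ω)) ⁻¹' s i = f i ⁻¹' a i ∩ g i ⁻¹' b i := by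
    intro i
    rw [← he i]
    rfl
  have hone : ∀ i, P (f i ⁻¹' a i ∩ g i ⁻¹' b i) = P (f i ⁻¹' a i) * P (g i ⁻¹' b i) := by
    intro i
    have := hfg.comp (measurable_pi_apply i) (measurable_pi_apply i)
    exact this.measure_inter_preimage_eq_mul _ _ (ha i) (hb i)
  simp_rw [hpre, hone]
  rw [Finset.prod_mul_distrib, ← hf.measure_inter_preimage_eq_mul S fun i _ => ha i,
    ← hg.measure_inter_preimage_eq_mul S fun i _ => hb i]
  have hA : MeasurableSet (⋂ i ∈ S, (fun F : ι → β => F i) ⁻¹' a i) :=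
    S.measurableSet_biInter fun i _ => measurable_pi_apply i (ha i)
  have hB : MeasurableSet (⋂ i ∈ S, (fun F : ι → γ => F i) ⁻¹' b i) :=
    S.measurableSet_biInter fun i _ => measurable_pi_apply i (hb i)
  have h1 := hfg.measure_inter_preimage_eq_mul _ _ hA hB
  simp only [Set.preimage_iInter] at h1
  refine Eq.trans (congrArg P ?_) h1
  ext ω
  simp only [Set.mem_iInter, Set.mem_inter_iff, Set.mem_preimage]
  exact forall₂_and

end Independence

/-! ### The sample covariance as a quadratic form. -/

section SampleCovariance

variable {κ N : ℕ}

theorem l2Inner_sub_left {X : Type*} [Fintype X] (f g U : X → ℝ) :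
    l2Inner (fun x => f x - g x) U = l2Inner f U - l2Inner g U := by
  simp only [l2Inner, sub_mul, Finset.sum_sub_distrib, mul_sub]

theorem l2Inner_sampleMean (w : Fin N → Pixel κ → ℝ) (U : Pixel κ → ℝ) :
    l2Inner (sampleMean w) U = (N : ℝ)⁻¹ * ∑ i, l2Inner (w i) U := by
  simp only [l2Inner, sampleMean, Finset.mul_sum, Finset.sum_mul]
  rw [Finset.sum_comm]
  refine Finset.sum_congr rfl fun i _ => Finset.sum_congr rfl fun x _ => ?_
  ring

/-- The sample covariance does not change under a common shift `c`. With `c` the true mean it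
becomes a sum of independent products minus a product of two small sums. -/
theorem pairing_sampleCov (hN : 1 ≤ N) (w : Fin N → Pixel κ → ℝ) (c U V : Pixel κ → ℝ) :
    pairing (sampleCov w) U V = ((N : ℝ) - 1)⁻¹ *
      (∑ i, l2Inner (fun x => w i x - c x) U * l2Inner (fun x => w i x - c x) V -
        (N : ℝ)⁻¹ * (∑ i, l2Inner (fun x => w i x - c x) U) *
          ∑ i, l2Inner (fun x => w i x - c x) V) := by
  have hN0 : (N : ℝ) ≠ 0 := by positivity
  have h1 : pairing (sampleCov w) U V = ((N : ℝ) - 1)⁻¹ *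
      ∑ i, l2Inner (fun x => w i x - sampleMean w x) U *
        l2Inner (fun x => w i x - sampleMean w x) V := by
    simp only [pairing, sampleCov, l2Inner, Finset.mul_sum, Finset.sum_mul]
    rw [Finset.sum_comm]
    simp_rw [Finset.sum_comm (s := (Finset.univ : Finset (Pixel κ))) (t := (Finset.univ : Finset (Fin N)))]
    refine Finset.sum_congr rfl fun i _ => Finset.sum_congr rfl fun y _ =>
      Finset.sum_congr rfl fun x _ => ?_
    ring
  rw [h1]
  congr 1
  simp only [l2Inner_sub_left, l2Inner_sampleMean, Finset.sum_sub_distrib, Finset.sum_const,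
    Finset.card_univ, Fintype.card_fin, nsmul_eq_mul, sub_mul, mul_sub, ← Finset.sum_mul,
    ← Finset.mul_sum]
  field_simp
  ring

end SampleCovariance

/-! ### Scores of the observed images and their deviation. -/

section Model

variable {Ω : Type*} [MeasurableSpace Ω] {P : Measure Ω} {κ N : ℕ}
  {I ε : Fin N → Pixel κ → Ω → ℝ} {Istar : Pixel κ → ℝ} {Sig : Pixel κ → Pixel κ → ℝ} {Cδ Cε : ℝ≥0}

theorem l2Norm_sq {X : Type*} [Fintype X] (U : X → ℝ) : l2Norm U ^ 2 = l2Inner U U := by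
  refine Real.sq_sqrt ?_
  exact mul_nonneg (by positivity) (Finset.sum_nonneg fun x _ => mul_self_nonneg _)

theorem l2Inner_add_left {X : Type*} [Fintype X] (f g U : X → ℝ) :
    l2Inner (fun x => f x + g x) U = l2Inner f U + l2Inner g U := by
  simp only [l2Inner, add_mul, Finset.sum_add_distrib, mul_add]

@[fun_prop]
theorem measurable_l2Inner_left {X : Type*} [Fintype X] (U : X → ℝ) :
    Measurable fun f : X → ℝ => l2Inner f U := by
  unfold l2Inner
  fun_prop

namespace IsSignalNoise

theorem exists_noise_mean (h : IsSignalNoise P I ε Istar Sig Cδ Cε) :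
    ∃ e : ℝ, ∀ i x, ∫ ω, ε i x ω ∂P = e := by
  by_cases hne : Nonempty (Fin N × Pixel κ)
  · obtain ⟨p⟩ := hne
    exact ⟨∫ ω, ε p.1 p.2 ω ∂P, fun i x => (h.noise_ident (i, x) p).integral_eq⟩
  · exact ⟨0, fun i x => absurd ⟨(i, x)⟩ hne⟩

theorem noise_hasSubgaussianMGF (h : IsSignalNoise P I ε Istar Sig Cδ Cε) {e : ℝ}
    (he : ∀ i x, ∫ ω, ε i x ω ∂P = e) (i : Fin N) (x : Pixel κ) :
    HasSubgaussianMGF (fun ω => ε i x ω - e) (Cε ^ 2) P := by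
  simpa [he] using h.noise_subgaussian i x

theorem exists_noise_variance [IsProbabilityMeasure P] (h : IsSignalNoise P I ε Istar Sig Cδ Cε)
    {e : ℝ} (he : ∀ i x, ∫ ω, ε i x ω ∂P = e) :
    ∃ v : ℝ, 0 ≤ v ∧ v ≤ 8 * (Cε ^ 2 + 1) ∧
      ∀ i x, ∫ ω, (ε i x ω - e) * (ε i x ω - e) ∂P = v := by
  by_cases hne : Nonempty (Fin N × Pixel κ)
  · obtain ⟨p⟩ := hne
    refine ⟨∫ ω, (ε p.1 p.2 ω - e) * (ε p.1 p.2 ω - e) ∂P,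
      integral_nonneg fun ω => mul_self_nonneg _, ?_, fun i x => ?_⟩
    · have := HasExpMoment.integral_mul_self_le (c := Cε ^ 2 + 1)
        ((h.noise_meas p.1 p.2).sub_const e)
        (by positivity)
        (hasSubgaussianMGF_mono (h.noise_hasSubgaussianMGF he p.1 p.2) (by simp))
      simpa using this
    · have h1 := (h.noise_ident (i, x) p).comp
        (u := fun z : ℝ => (z - e) * (z - e)) (by fun_prop)
      exact h1.integral_eq
  · exact ⟨0, le_rfl, by positivity, fun i x => absurd ⟨(i, x)⟩ hne⟩

/-- Testing against `|X|` times an indicator evaluates at one pixel. The constant may grow with the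
grid: only square integrability is drawn from it. -/
theorem signal_pixel_hasSubgaussianMGF (h : IsSignalNoise P I ε Istar Sig Cδ Cε) (i : Fin N)
    (x : Pixel κ) : ∃ c : ℝ≥0, HasSubgaussianMGF (fun ω => I i x ω - Istar x) c P := by
  classical
  refine ⟨_, (h.signal_subgaussian i
    (fun y => if y = x then (Fintype.card (Pixel κ) : ℝ) else 0)).congr (ae_of_all _ fun ω => ?_)⟩
  have : (Fintype.card (Pixel κ) : ℝ) ≠ 0 := by
    have : Nonempty (Pixel κ) := ⟨x⟩
    exact_mod_cast Fintype.card_ne_zero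
  simp only [l2Inner, mul_ite, mul_zero, Finset.sum_ite_eq', Finset.mem_univ, if_true]
  field_simp

theorem signal_hasSubgaussianMGF (h : IsSignalNoise P I ε Istar Sig Cδ Cε) (i : Fin N)
    {U : Pixel κ → ℝ} (hU : l2Norm U ≤ 1) :
    HasSubgaussianMGF (fun ω => l2Inner (fun x => I i x ω - Istar x) U) (Cδ ^ 2) P := by
  refine hasSubgaussianMGF_mono (h.signal_subgaussian i U) ?_
  have : (l2Norm U).toNNReal ≤ 1 := by
    rw [Real.toNNReal_le_iff_le_coe]; simpa using hU
  calc Cδ ^ 2 * (l2Norm U).toNNReal ^ 2 ≤ Cδ ^ 2 * 1 ^ 2 := by gcongr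
    _ = Cδ ^ 2 := by simp

theorem noise_l2Inner_hasSubgaussianMGF (h : IsSignalNoise P I ε Istar Sig Cδ Cε) {e : ℝ}
    (he : ∀ i x, ∫ ω, ε i x ω ∂P = e) (i : Fin N)
    {U : Pixel κ → ℝ} (hU : l2Norm U ≤ 1) :
    HasSubgaussianMGF (fun ω => l2Inner (fun x => ε i x ω - e) U) (Cε ^ 2) P := by
  set a : Pixel κ → ℝ := fun x => (Fintype.card (Pixel κ) : ℝ)⁻¹ * U x with ha
  have hind : iIndepFun (fun (x : Pixel κ) ω => a x * (ε i x ω - e)) P :=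
    (h.noise_indep.precomp (g := fun x : Pixel κ => (i, x)) fun x y hxy => by simpa using hxy).comp
      (fun x z => a x * (z - e)) fun x => by fun_prop
  have hsum := HasSubgaussianMGF.sum_of_iIndepFun hind (s := Finset.univ)
    fun x _ => (h.noise_hasSubgaussianMGF he i x).const_mul (a x)
  refine (hasSubgaussianMGF_mono hsum ?_).congr (ae_of_all _ fun ω => ?_)
  · rw [← NNReal.coe_le_coe]
    push_cast
    change ∑ x, a x ^ 2 * (Cε : ℝ) ^ 2 ≤ (Cε : ℝ) ^ 2
    rw [← Finset.sum_mul]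
    refine mul_le_of_le_one_left (sq_nonneg _) ?_
    rcases isEmpty_or_nonempty (Pixel κ) with hX | hX
    · simp
    have hcard : (1 : ℝ) ≤ Fintype.card (Pixel κ) := by exact_mod_cast Fintype.card_pos
    have h1 : ∑ x, a x ^ 2 = (Fintype.card (Pixel κ) : ℝ)⁻¹ * l2Inner U U := by
      simp only [ha, l2Inner, Finset.mul_sum]
      refine Finset.sum_congr rfl fun x _ => ?_
      ring
    -- The proxy is in fact smaller by the number of pixels; the cruder bound suffices.
    rw [h1, ← l2Norm_sq]
    have h2 : l2Norm U ^ 2 ≤ 1 := pow_le_one₀ (Real.sqrt_nonneg _) hU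
    exact mul_le_one₀ (inv_le_one_of_one_le₀ hcard) (sq_nonneg _) h2
  · simp only [ha, l2Inner, Finset.mul_sum]
    refine Finset.sum_congr rfl fun x _ => ?_
    ring

/-- The centred scores `⟨Wᵢ - E Wᵢ, U⟩` are sub-Gaussian. -/
theorem score_hasSubgaussianMGF (h : IsSignalNoise P I ε Istar Sig Cδ Cε) {e : ℝ}
    (he : ∀ i x, ∫ ω, ε i x ω ∂P = e) (i : Fin N) {U : Pixel κ → ℝ} (hU : l2Norm U ≤ 1) :
    HasSubgaussianMGF (fun ω => l2Inner (fun x => I i x ω + ε i x ω - (Istar x + e)) U)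
      (Cδ ^ 2 + Cε ^ 2 + 1) P := by
  have hind : IndepFun (fun ω => l2Inner (fun x => I i x ω - Istar x) U)
      (fun ω => l2Inner (fun x => ε i x ω - e) U) P :=
    h.signal_indep_noise.comp (φ := fun F : Fin N → Pixel κ → ℝ => l2Inner (fun x => F i x - Istar x) U)
      (ψ := fun F : Fin N → Pixel κ → ℝ => l2Inner (fun x => F i x - e) U)
      (by unfold l2Inner; fun_prop) (by unfold l2Inner; fun_prop)
  have := (h.signal_hasSubgaussianMGF i hU).add_of_indepFun
    (h.noise_l2Inner_hasSubgaussianMGF he i hU) hind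
  refine (hasSubgaussianMGF_mono this (by simp)).congr (ae_of_all _ fun ω => ?_)
  simp only
  rw [← l2Inner_add_left]
  congr 1
  ext x
  ring

theorem measurable_score (h : IsSignalNoise P I ε Istar Sig Cδ Cε) (e : ℝ) (i : Fin N)
    (U : Pixel κ → ℝ) :
    Measurable (fun ω => l2Inner (fun x => I i x ω + ε i x ω - (Istar x + e)) U) := by
  have h1 := h.signal_meas
  have h2 := h.noise_meas
  unfold l2Inner
  fun_prop

theorem iIndepFun_image (h : IsSignalNoise P I ε Istar Sig Cδ Cε) (e : ℝ) :
    iIndepFun (fun i ω (x : Pixel κ) => I i x ω + ε i x ω - (Istar x + e)) P := by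
  have h1 := h.signal_meas
  have h2 := h.noise_meas
  have hpair := iIndepFun.prodMk (f := fun i ω (x : Pixel κ) => I i x ω)
    (g := fun i ω (x : Pixel κ) => ε i x ω) (fun i => by fun_prop) (fun i => by fun_prop)
    h.signal_indep (iIndepFun.curry (fun p => h2 p.1 p.2) h.noise_indep) h.signal_indep_noise
  exact hpair.comp (fun _ p x => p.1 x + p.2 x - (Istar x + e)) fun i => by fun_prop

/-- The covariance of the scores. -/
theorem integral_score_mul_score [IsProbabilityMeasure P]
    (h : IsSignalNoise P I ε Istar Sig Cδ Cε) {e v : ℝ}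
    (he : ∀ i x, ∫ ω, ε i x ω ∂P = e)
    (hv : ∀ i x, ∫ ω, (ε i x ω - e) * (ε i x ω - e) ∂P = v) (i : Fin N) (U V : Pixel κ → ℝ) :
    ∫ ω, l2Inner (fun x => I i x ω + ε i x ω - (Istar x + e)) U *
      l2Inner (fun x => I i x ω + ε i x ω - (Istar x + e)) V ∂P
      = pairing (fun x y => Sig x y + if x = y then v else 0) U V := by
  set p : Pixel κ → Ω → ℝ := fun x ω => I i x ω - Istar x
  set n : Pixel κ → Ω → ℝ := fun x ω => ε i x ω - e
  have hp : ∀ x, MemLp (p x) 2 P := fun x => by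
    obtain ⟨c, hc⟩ := h.signal_pixel_hasSubgaussianMGF i x
    exact hc.memLp 2
  have hn : ∀ x, MemLp (n x) 2 P := fun x => (h.noise_hasSubgaussianMGF he i x).memLp 2
  have hn0 : ∀ x, ∫ ω, n x ω ∂P = 0 := by
    intro x
    have hint : Integrable (fun ω => ε i x ω) P := by
      refine (((hn x).integrable (by norm_num)).add (integrable_const e)).congr
        (ae_of_all _ fun ω => ?_)
      simp [n]
    simp only [n]
    rw [integral_sub hint (integrable_const e), he]
    simp
  have hpp : ∀ x y, ∫ ω, p x ω * p y ω ∂P = Sig x y := by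
    intro x y
    rw [← h.signal_cov i x y, covariance, h.signal_mean, h.signal_mean]
  have hpn : ∀ x y, ∫ ω, p x ω * n y ω ∂P = 0 := by
    intro x y
    have hind : IndepFun (p x) (n y) P := h.signal_indep_noise.comp
      (φ := fun F : Fin N → Pixel κ → ℝ => F i x - Istar x)
      (ψ := fun F : Fin N → Pixel κ → ℝ => F i y - e) (by fun_prop) (by fun_prop)
    rw [hind.integral_fun_mul_eq_mul_integral (hp x).1 (hn y).1, hn0, mul_zero]
  have hnn : ∀ x y, ∫ ω, n x ω * n y ω ∂P = if x = y then v else 0 := by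
    intro x y
    split_ifs with hxy
    · rw [hxy]; exact hv i y
    · have hind : IndepFun (n x) (n y) P :=
        (h.noise_indep.indepFun (i := (i, x)) (j := (i, y)) (by simpa using hxy)).comp
          (φ := fun z => z - e) (ψ := fun z => z - e) (by fun_prop) (by fun_prop)
      rw [hind.integral_fun_mul_eq_mul_integral (hn x).1 (hn y).1, hn0, zero_mul]
  have hi1 : ∀ x y, Integrable (fun ω => p x ω * p y ω) P := fun x y => (hp x).integrable_mul (hp y)
  have hi2 : ∀ x y, Integrable (fun ω => p x ω * n y ω) P := fun x y => (hp x).integrable_mul (hn y)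
  have hi3 : ∀ x y, Integrable (fun ω => n x ω * p y ω) P := fun x y => (hn x).integrable_mul (hp y)
  have hi4 : ∀ x y, Integrable (fun ω => n x ω * n y ω) P := fun x y => (hn x).integrable_mul (hn y)
  have hexp : ∀ x y ω, (p x ω + n x ω) * (p y ω + n y ω)
      = p x ω * p y ω + p x ω * n y ω + n x ω * p y ω + n x ω * n y ω := fun x y ω => by ring
  have hi : ∀ x y, Integrable (fun ω => (p x ω + n x ω) * (p y ω + n y ω)) P := by
    intro x y
    simp_rw [hexp]
    exact (((hi1 x y).add (hi2 x y)).add (hi3 x y)).add (hi4 x y)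
  have hxy : ∀ x y, ∫ ω, (p x ω + n x ω) * (p y ω + n y ω) ∂P
      = Sig x y + if x = y then v else 0 := by
    intro x y
    have hnp : ∫ ω, n x ω * p y ω ∂P = 0 := by
      rw [← hpn y x]; congr 1; ext ω; ring
    simp_rw [hexp]
    rw [integral_add, integral_add, integral_add, hpp, hpn, hnp, hnn]
    · ring
    exacts [hi1 x y, hi2 x y, (hi1 x y).add (hi2 x y), hi3 x y,
      ((hi1 x y).add (hi2 x y)).add (hi3 x y), hi4 x y]
  have hprod : ∀ ω, l2Inner (fun x => I i x ω + ε i x ω - (Istar x + e)) U *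
      l2Inner (fun x => I i x ω + ε i x ω - (Istar x + e)) V
      = ((Fintype.card (Pixel κ) : ℝ)⁻¹) ^ 2 *
        ∑ x, ∑ y, (U x * V y) * ((p x ω + n x ω) * (p y ω + n y ω)) := by
    intro ω
    rw [l2Inner, l2Inner, mul_mul_mul_comm, Finset.sum_mul_sum, ← pow_two]
    congr 1
    refine Finset.sum_congr rfl fun x _ => Finset.sum_congr rfl fun y _ => ?_
    simp only [p, n]
    ring
  simp_rw [hprod]
  rw [integral_const_mul, integral_finsetSum _ fun x _ =>
    integrable_finsetSum _ fun y _ => (hi x y).const_mul _, pairing]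
  congr 1
  refine Finset.sum_congr rfl fun x _ => ?_
  rw [integral_finsetSum _ fun y _ => (hi x y).const_mul _]
  refine Finset.sum_congr rfl fun y _ => ?_
  rw [integral_const_mul, hxy]
  ring

/-- The deviation of the sample covariance from the covariance, at a pair of test functions. -/
theorem measure_pairing_sampleCov_ge_le [IsProbabilityMeasure P]
    (h : IsSignalNoise P I ε Istar Sig Cδ Cε) {e v : ℝ}
    (he : ∀ i x, ∫ ω, ε i x ω ∂P = e)
    (hv : ∀ i x, ∫ ω, (ε i x ω - e) * (ε i x ω - e) ∂P = v) {U V : Pixel κ → ℝ}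
    (hU : l2Norm U ≤ 1) (hV : l2Norm V ≤ 1) {c : ℝ≥0} (hc : c = Cδ ^ 2 + Cε ^ 2 + 1)
    (hN : 2 ≤ N) {d : ℝ} (hd : 1 ≤ d) (hdN : d ≤ N) :
    P.real {ω | 500 * c ^ 2 * Real.sqrt (d / N) ≤
      |pairing (sampleCov (fun i x => I i x ω + ε i x ω)) U V -
        pairing (fun x y => Sig x y + if x = y then v else 0) U V|}
      ≤ 6 * Real.exp (-(3 * d)) := by
  -- The summand `1` in `c` keeps it positive when both parameters vanish and gives `c ≤ c²` below.
  have hc1 : (1 : ℝ) ≤ c := by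
    rw [hc]; push_cast; nlinarith [sq_nonneg (Cδ : ℝ), sq_nonneg (Cε : ℝ)]
  have hc0 : 0 < c := by exact_mod_cast lt_of_lt_of_le one_pos hc1
  have hcR : (0 : ℝ) < c := by linarith
  have hN2 : (2 : ℝ) ≤ N := by exact_mod_cast hN
  have hN0 : (0 : ℝ) < N := by linarith
  set ρ := Real.sqrt (d / N)
  have hρ0 : 0 ≤ ρ := Real.sqrt_nonneg _
  have hρsq : ρ ^ 2 = d / N := Real.sq_sqrt (by positivity)
  have hNρ : N * ρ ^ 2 = d := by rw [hρsq]; field_simp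
  have hρ1 : ρ ≤ 1 := by
    have : d / N ≤ 1 := (div_le_one hN0).2 hdN
    nlinarith
  have hρN : 1 ≤ N * ρ := by nlinarith
  set A : Fin N → Ω → ℝ := fun i ω => l2Inner (fun x => I i x ω + ε i x ω - (Istar x + e)) U
  set B : Fin N → Ω → ℝ := fun i ω => l2Inner (fun x => I i x ω + ε i x ω - (Istar x + e)) V
  have hA : ∀ i, HasSubgaussianMGF (A i) c P := fun i => hc ▸ h.score_hasSubgaussianMGF he i hU
  have hB : ∀ i, HasSubgaussianMGF (B i) c P := fun i => hc ▸ h.score_hasSubgaussianMGF he i hV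
  have hAm : ∀ i, Measurable (A i) := fun i => h.measurable_score e i U
  have hBm : ∀ i, Measurable (B i) := fun i => h.measurable_score e i V
  have himg := h.iIndepFun_image e
  have hAi : iIndepFun A P := himg.comp (fun _ w => l2Inner w U) fun i => by fun_prop
  have hBi : iIndepFun B P := himg.comp (fun _ w => l2Inner w V) fun i => by fun_prop
  have hABi : iIndepFun (fun i ω => A i ω * B i ω) P :=
    himg.comp (fun _ w => l2Inner w U * l2Inner w V) fun i => by fun_prop
  have hAB : ∀ i, HasExpMoment (fun ω => A i ω * B i ω) (1 / (4 * c)) P := fun i =>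
    hasExpMoment_mul (hAm i) (hBm i) hc0 (hA i) (hB i)
  set G := pairing (fun x y => Sig x y + if x = y then v else 0) U V
  have hG : ∀ i, ∫ ω, A i ω * B i ω ∂P = G := fun i => h.integral_score_mul_score he hv i U V
  have hGle : |G| ≤ 8 * c := by
    have := (hAB ⟨0, by omega⟩).abs_integral_le (by positivity)
    rw [hG] at this
    refine this.trans (le_of_eq ?_)
    field_simp
    norm_num
  -- The levels `160 c ρ` and `3 c ρ` make every exponent at least `3 d`: the rates are `25/8 · d`
  -- and `9/2 · c d`. Here `ρ ≤ 1` keeps `160 c ρ` below the Bernstein limit `128 / a = 512 c`.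
  have b1 := HasExpMoment.measure_abs_sum_ge_le hAB (by positivity) hABi
    (t := 160 * c * ρ) (by positivity) (by field_simp; nlinarith)
  have b2 := measure_abs_sum_subgaussian_ge_le hc0 hA hAi (t := 3 * c * ρ) (by positivity)
  have b3 := measure_abs_sum_subgaussian_ge_le hc0 hB hBi (t := 3 * c * ρ) (by positivity)
  have e1 : Real.exp (-(N * ((1 / (4 * (c : ℝ))) ^ 2 * (160 * c * ρ) ^ 2 / 512)))
      ≤ Real.exp (-(3 * d)) := by
    apply Real.exp_le_exp.2
    have : N * ((1 / (4 * (c : ℝ))) ^ 2 * (160 * c * ρ) ^ 2 / 512) = 25 / 8 * (N * ρ ^ 2) := by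
      field_simp; ring
    rw [this, hNρ]; linarith
  have e2 : Real.exp (-(N * ((3 * c * ρ) ^ 2 / (2 * (c : ℝ))))) ≤ Real.exp (-(3 * d)) := by
    apply Real.exp_le_exp.2
    have : N * ((3 * c * ρ) ^ 2 / (2 * (c : ℝ))) = 9 / 2 * c * (N * ρ ^ 2) := by
      field_simp; ring
    rw [this, hNρ]; nlinarith
  simp_rw [hG] at b1
  have hsub : {ω | 500 * c ^ 2 * ρ ≤
      |pairing (sampleCov (fun i x => I i x ω + ε i x ω)) U V - G|} ⊆
      {ω | N * (160 * c * ρ) ≤ |∑ i, (A i ω * B i ω - G)|} ∪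
        ({ω | N * (3 * c * ρ) ≤ |∑ i, A i ω|} ∪ {ω | N * (3 * c * ρ) ≤ |∑ i, B i ω|}) := by
    intro ω hω
    by_contra hno
    simp only [Set.mem_union, Set.mem_ofPred_eq, not_or, not_le] at hno
    obtain ⟨h1, h2, h3⟩ := hno
    rw [Set.mem_ofPred_eq, pairing_sampleCov (by omega) _ (fun x => Istar x + e)] at hω
    set S := ∑ i, (A i ω * B i ω - G) with hS
    have hSe : ∑ i, A i ω * B i ω = S + N * G := by
      rw [hS, Finset.sum_sub_distrib]; simp
    set a := ∑ i, A i ω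
    set b := ∑ i, B i ω
    change 500 * c ^ 2 * ρ ≤ |((N : ℝ) - 1)⁻¹ * (∑ i, A i ω * B i ω - (N : ℝ)⁻¹ * a * b) - G| at hω
    have hN1 : (0 : ℝ) < N - 1 := by linarith
    have e3 : ((N : ℝ) - 1)⁻¹ * (∑ i, A i ω * B i ω - (N : ℝ)⁻¹ * a * b) - G
        = ((N : ℝ) - 1)⁻¹ * (S + G - (N : ℝ)⁻¹ * a * b) := by
      rw [hSe]; field_simp; ring
    have hab : |(N : ℝ)⁻¹ * a * b| ≤ 9 * c ^ 2 * (N * ρ) := by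
      rw [abs_mul, abs_mul, abs_of_pos (inv_pos.2 hN0), mul_assoc, inv_mul_le_iff₀ hN0]
      calc |a| * |b| ≤ (N * (3 * c * ρ)) * (N * (3 * c * ρ)) :=
            mul_le_mul h2.le h3.le (abs_nonneg _) (by positivity)
        _ = N * (9 * c ^ 2 * (N * ρ)) * ρ := by ring
        _ ≤ N * (9 * c ^ 2 * (N * ρ)) := mul_le_of_le_one_right (by positivity) hρ1
    have htot : |S + G - (N : ℝ)⁻¹ * a * b|
        < N * (160 * c * ρ) + 8 * c + 9 * c ^ 2 * (N * ρ) := by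
      have t1 := abs_sub (S + G) ((N : ℝ)⁻¹ * a * b)
      have t2 := abs_add_le S G
      linarith
    have hcc : (c : ℝ) ≤ c ^ 2 := by nlinarith
    -- The constants add up to `160 + 8 + 9 = 177`, below the `250` left from `500` after `N - 1 ≥ N
    -- / 2`.
    have hfin : N * (160 * c * ρ) + 8 * c + 9 * c ^ 2 * (N * ρ) ≤ 177 * c ^ 2 * (N * ρ) := by
      have t1 : (c : ℝ) * (N * ρ) ≤ c ^ 2 * (N * ρ) := by gcongr
      have t2 : (c : ℝ) * 1 ≤ c * (N * ρ) := by gcongr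
      linarith
    rw [e3, abs_mul, abs_of_pos (inv_pos.2 hN1), le_inv_mul_iff₀ hN1] at hω
    have t3 : (N : ℝ) / 2 ≤ N - 1 := by linarith
    have t4 : (N : ℝ) / 2 * (500 * c ^ 2 * ρ) ≤ (N - 1) * (500 * c ^ 2 * ρ) := by gcongr
    have t5 : 0 ≤ (c : ℝ) ^ 2 * (N * ρ) := by positivity
    linarith
  refine (measureReal_mono hsub).trans ((measureReal_union_le _ _).trans
    (le_trans (add_le_add le_rfl (measureReal_union_le _ _)) ?_))
  linarith

end IsSignalNoise

end Model

/-! ### Operator norm of the projected fluctuation. -/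

section Concentration

open scoped InnerProductSpace

variable {Ω : Type*} [MeasurableSpace Ω] {P : Measure Ω} {κ N : ℕ}
  {I ε : Fin N → Pixel κ → Ω → ℝ} {Istar : Pixel κ → ℝ} {Sig : Pixel κ → Pixel κ → ℝ} {Cδ Cε : ℝ≥0}

/-- White noise acts as a multiple of the identity, with factor `v / |X|` because of the
normalisation. This is the source of the `κ^{-2}` term. -/
theorem norm_kernelCLM_diagonal_le {X : Type*} [Fintype X] [DecidableEq X] [Nonempty X] {v : ℝ}
    (hv : 0 ≤ v) :
    ‖kernelCLM (fun x y : X => if x = y then v else 0)‖ ≤ v / Fintype.card X := by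
  refine ContinuousLinearMap.opNorm_le_bound _ (by positivity) fun x => ?_
  obtain ⟨V, rfl⟩ := toEuclid_surjective x
  have h : kernelApply (fun x y : X => if x = y then v else 0) V
      = (v / Fintype.card X) • V := by
    ext x
    simp [kernelApply]
    ring
  rw [kernelCLM_toEuclid, h, map_smul, norm_smul, Real.norm_of_nonneg (by positivity)]

/-- The operator norm of the stochastic error after projection, outside an event of
exponentially small probability. -/
theorem IsSignalNoise.measure_norm_compression_gt_le [IsProbabilityMeasure P] (hκ : 1 ≤ κ)
    (h : IsSignalNoise P I ε Istar Sig Cδ Cε) {φ : ℕ → Fin κ → ℝ}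
    (hφ : OrthonormalOn (Finset.Icc 1 κ) φ) {m l : ℕ} (hm : 1 ≤ m) (hN : 2 ≤ N)
    (hd : m ^ 2 + l ^ 2 ≤ N) {c : ℝ≥0} (hc : c = Cδ ^ 2 + Cε ^ 2 + 1) :
    P.real {ω | 2000 * c ^ 2 * Real.sqrt (((m ^ 2 + l ^ 2 : ℕ) : ℝ) / N) + 8 * c / (κ : ℝ) ^ 2 <
      ‖(gridSpan φ m).starProjection.comp
        ((kernelCLM (sampleCov (fun i x => I i x ω + ε i x ω)) - kernelCLM Sig).comp
          (gridSpan φ l).starProjection)‖} ≤ 6 * Real.exp (-(m ^ 2 + l ^ 2 : ℕ)) := by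
  have : Nonempty (Fin κ) := ⟨⟨0, hκ⟩⟩
  obtain ⟨e, he⟩ := h.exists_noise_mean
  obtain ⟨v, hv0, hv8, hv⟩ := h.exists_noise_variance he
  have hvc : v ≤ 8 * c := by
    rw [hc]; push_cast; nlinarith [sq_nonneg (Cδ : ℝ)]
  obtain ⟨s, s', hs, hs', h1, h1', hnet⟩ := exists_nets_norm_comp_le (gridSpan φ m) (gridSpan φ l)
  choose T hT using toEuclid_surjective (X := Pixel κ)
  set d : ℕ := m ^ 2 + l ^ 2 with hd'
  set ρ := Real.sqrt ((d : ℝ) / N)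
  set Sw : Pixel κ → Pixel κ → ℝ := fun x y => Sig x y + if x = y then v else 0
  set Sh : Ω → Pixel κ → Pixel κ → ℝ := fun ω => sampleCov (fun i x => I i x ω + ε i x ω)
  set bad : EuclideanSpace ℝ (Pixel κ) → EuclideanSpace ℝ (Pixel κ) → Set Ω := fun y z =>
    {ω | 500 * c ^ 2 * ρ ≤ |pairing (Sh ω) (T y) (T z) - pairing Sw (T y) (T z)|}
  have hd1 : (1 : ℝ) ≤ d := by
    have : 1 ≤ d := by nlinarith
    exact_mod_cast this
  have hTn : ∀ y : EuclideanSpace ℝ (Pixel κ), ‖y‖ ≤ 1 → l2Norm (T y) ≤ 1 := fun y hy => by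
    rw [← norm_toEuclid, hT]; exact hy
  have hbad : ∀ y ∈ s, ∀ z ∈ s', P.real (bad y z) ≤ 6 * Real.exp (-(3 * d)) := fun y hy z hz =>
    h.measure_pairing_sampleCov_ge_le he hv (hTn y (h1 y hy)) (hTn z (h1' z hz)) hc hN hd1
      (by exact_mod_cast hd)
  have hsub : {ω | 2000 * c ^ 2 * ρ + 8 * c / (κ : ℝ) ^ 2 <
      ‖(gridSpan φ m).starProjection.comp
        ((kernelCLM (Sh ω) - kernelCLM Sig).comp (gridSpan φ l).starProjection)‖}
      ⊆ ⋃ p ∈ s ×ˢ s', bad p.1 p.2 := by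
    intro ω hω
    by_contra hno
    simp only [Set.mem_iUnion, not_exists, Finset.mem_product, and_imp, Prod.forall] at hno
    rw [Set.mem_ofPred_eq, ← not_le] at hω
    apply hω
    have hgood := hnet (kernelCLM (Sh ω) - kernelCLM Sw) (500 * c ^ 2 * ρ) (by positivity)
      fun y hy z hz => by
        have := hno y z hy hz
        simp only [bad, Set.mem_ofPred_eq, not_le] at this
        rw [← hT y, ← hT z, sub_apply, inner_sub_right, inner_kernelCLM, inner_kernelCLM]
        exact (le_abs_self _).trans this.le
    set D := kernelCLM (fun x y : Pixel κ => if x = y then v else 0)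
    have hDn : ‖D‖ ≤ 8 * c / (κ : ℝ) ^ 2 := by
      refine (norm_kernelCLM_diagonal_le hv0).trans ?_
      have : (Fintype.card (Pixel κ) : ℝ) = (κ : ℝ) ^ 2 := by simp [sq]
      rw [this]
      gcongr
    have hSw : kernelCLM Sw = kernelCLM Sig + D := kernelCLM_add _ _
    have hsplit : (gridSpan φ m).starProjection.comp
        ((kernelCLM (Sh ω) - kernelCLM Sig).comp (gridSpan φ l).starProjection)
        = (gridSpan φ m).starProjection.comp
        ((kernelCLM (Sh ω) - kernelCLM Sw).comp (gridSpan φ l).starProjection)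
        + (gridSpan φ m).starProjection.comp (D.comp (gridSpan φ l).starProjection) := by
      rw [hSw]
      ext1 x
      simp only [sub_apply, add_apply, ContinuousLinearMap.comp_apply, map_sub, map_add]
      abel
    have hDc : ‖(gridSpan φ m).starProjection.comp (D.comp (gridSpan φ l).starProjection)‖ ≤ ‖D‖ := by
      refine ContinuousLinearMap.opNorm_le_bound _ (norm_nonneg _) fun x => ?_
      refine (Submodule.norm_starProjection_apply_le _ _).trans ((D.le_opNorm _).trans ?_)
      exact mul_le_mul_of_nonneg_left (Submodule.norm_starProjection_apply_le _ _) (norm_nonneg _)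
    rw [hsplit]
    refine (norm_add_le _ _).trans ?_
    linarith
  -- The number `5^d ≤ e^{2d}` of pairs is absorbed by the pointwise tail `6 e^{-3d}`.
  have hcard : ((s ×ˢ s').card : ℝ) ≤ Real.exp (2 * d) := by
    have hn : (s ×ˢ s').card ≤ 5 ^ d := by
      rw [Finset.card_product, hd', pow_add]
      rw [finrank_gridSpan hφ] at hs hs'
      exact Nat.mul_le_mul
        (hs.trans (Nat.pow_le_pow_right (by norm_num) (Nat.pow_le_pow_left (min_le_left _ _) _)))
        (hs'.trans (Nat.pow_le_pow_right (by norm_num) (Nat.pow_le_pow_left (min_le_left _ _) _)))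
    have h5 : (5 : ℝ) ≤ Real.exp 2 := by
      have : Real.exp 2 = Real.exp 1 ^ 2 := by rw [← Real.exp_nat_mul]; norm_num
      rw [this]
      have := Real.exp_one_gt_d9
      nlinarith
    calc ((s ×ˢ s').card : ℝ) ≤ (5 : ℝ) ^ d := by exact_mod_cast hn
      _ ≤ Real.exp 2 ^ d := by gcongr
      _ = Real.exp (2 * d) := by rw [← Real.exp_nat_mul]; congr 1; ring
  calc P.real _ ≤ P.real (⋃ p ∈ s ×ˢ s', bad p.1 p.2) := measureReal_mono hsub (measure_ne_top _ _)
    _ ≤ ∑ p ∈ s ×ˢ s', P.real (bad p.1 p.2) := measureReal_biUnion_finset_le _ _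
    _ ≤ ∑ _p ∈ s ×ˢ s', 6 * Real.exp (-(3 * d)) := Finset.sum_le_sum fun p hp =>
        hbad _ (Finset.mem_product.1 hp).1 _ (Finset.mem_product.1 hp).2
    _ = (s ×ˢ s').card * (6 * Real.exp (-(3 * d))) := by simp
    _ ≤ Real.exp (2 * d) * (6 * Real.exp (-(3 * d))) := by gcongr
    _ = 6 * Real.exp (-d) := by
        rw [mul_left_comm, ← Real.exp_add]; congr 2; ring

end Concentration

/-! ### Rates in the sample size. -/

section Asymptotics

/-- A deterministic bound for the rate, for an error which is dominated by the deviation,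
the noise variance and the approximation error. -/
theorem sq_le_of_le_rate {x A c t k s : ℝ} (hx0 : 0 ≤ x) (hs : 0 < s)
    (hx : x ≤ 16 * (A * t + c * k) / s) :
    x ^ 2 ≤ 512 * (A ^ 2 + c ^ 2) * ((s ^ 2)⁻¹ * t ^ 2 + (s ^ 2)⁻¹ * k ^ 2) := by
  have h1 : x ^ 2 ≤ (16 * (A * t + c * k) / s) ^ 2 := by gcongr
  refine h1.trans ?_
  rw [div_pow, div_eq_inv_mul, ← mul_add, mul_left_comm]
  refine mul_le_mul_of_nonneg_left ?_ (by positivity)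
  nlinarith [sq_nonneg (A * t - c * k), sq_nonneg (A * k), sq_nonneg (c * t)]

/-- The exponents combine as `1 / (2α + 2) - 1 / 2 = -α / (2α + 2)`. -/
theorem sqrt_dimension_div_le {N : ℕ} (hN : 1 ≤ N) {α b₂ b₃ : ℝ} (hα : 0 < α) {m l : ℕ}
    (hm : (m : ℝ) ≤ b₂ * (N : ℝ) ^ (1 / (2 * α + 2)))
    (hl : (l : ℝ) ≤ b₃ * (N : ℝ) ^ (1 / (2 * α + 2))) :
    Real.sqrt (((m ^ 2 + l ^ 2 : ℕ) : ℝ) / N) ≤ (b₂ + b₃) * (N : ℝ) ^ (-(α / (2 * α + 2))) := by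
  have hN0 : (0 : ℝ) < N := by exact_mod_cast hN
  have h1 : ((m ^ 2 + l ^ 2 : ℕ) : ℝ) ≤ ((m : ℝ) + l) ^ 2 := by
    push_cast
    nlinarith [mul_nonneg (Nat.cast_nonneg (α := ℝ) m) (Nat.cast_nonneg (α := ℝ) l)]
  calc Real.sqrt (((m ^ 2 + l ^ 2 : ℕ) : ℝ) / N) ≤ Real.sqrt (((m : ℝ) + l) ^ 2 / N) := by gcongr
    _ = ((m : ℝ) + l) / Real.sqrt N := by
        rw [Real.sqrt_div (sq_nonneg _), Real.sqrt_sq (by positivity)]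
    _ ≤ ((b₂ + b₃) * (N : ℝ) ^ (1 / (2 * α + 2))) / Real.sqrt N := by
        gcongr; linarith
    _ = (b₂ + b₃) * (N : ℝ) ^ (-(α / (2 * α + 2))) := by
        rw [Real.sqrt_eq_rpow, mul_div_assoc, ← Real.rpow_sub hN0]
        congr 2
        field_simp
        ring

/-- This places the deviation level `√((m² + ℓ²) / N)` below `1`, the range where the Bernstein tail
is Gaussian. -/
theorem eventually_dimension_le {α b₂ b₃ : ℝ} (hα : 0 < α) {m l : ℕ → ℕ}
    (hm : ∀ᶠ N : ℕ in atTop, (m N : ℝ) ≤ b₂ * (N : ℝ) ^ (1 / (2 * α + 2)))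
    (hl : ∀ᶠ N : ℕ in atTop, (l N : ℝ) ≤ b₃ * (N : ℝ) ^ (1 / (2 * α + 2))) :
    ∀ᶠ N : ℕ in atTop, m N ^ 2 + l N ^ 2 ≤ N := by
  have hβ : 0 < α / (2 * α + 2) := by positivity
  have hlim : Tendsto (fun N : ℕ => (b₂ + b₃) * (N : ℝ) ^ (-(α / (2 * α + 2)))) atTop (nhds 0) := by
    have := ((tendsto_rpow_neg_atTop hβ).comp tendsto_natCast_atTop_atTop).const_mul (b₂ + b₃)
    simpa using this
  filter_upwards [hm, hl, hlim.eventually_le_const (by norm_num : (0 : ℝ) < 1),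
    eventually_ge_atTop 1] with N h1 h2 h3 h4
  have h5 := (sqrt_dimension_div_le h4 hα h1 h2).trans h3
  have hN0 : (0 : ℝ) < N := by exact_mod_cast h4
  rw [Real.sqrt_le_left zero_le_one, one_pow, div_le_one hN0] at h5
  exact_mod_cast h5

theorem limsup_lt_ofReal_of_eventually_le {f : ℕ → ℝ≥0∞} {g : ℕ → ℝ} {η : ℝ} (hη : 0 < η)
    (hg : Tendsto g atTop (nhds 0)) (h : ∀ᶠ N in atTop, f N ≤ ENNReal.ofReal (g N)) :
    limsup f atTop < ENNReal.ofReal η := by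
  have h1 : ∀ᶠ N in atTop, f N ≤ ENNReal.ofReal (η / 2) := by
    filter_upwards [h, hg.eventually_le_const (half_pos hη)] with N h1 h2
    exact h1.trans (ENNReal.ofReal_le_ofReal h2)
  refine (limsup_le_of_le (by isBoundedDefault) h1).trans_lt ?_
  exact (ENNReal.ofReal_lt_ofReal_iff hη).2 (half_lt_self hη)

end Asymptotics

end ImagePCA

/-! ### The convergence rate. -/

theorem corollary4
    -- smoothness, constants in `γ_k ≍ k^{-2α}`, bound on the RKHS norm, sub-Gaussian parameters
    (α : ℝ) (hα : 0 < α) (c₁ c₂ B : ℝ) (hc₁ : 0 < c₁) (hc₂ : 0 < c₂) (Cδ Cε : ℝ≥0) :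
    ∃ C : ℝ, 0 < C ∧
    -- constants in the choice of the dimensions `m` and `l`
    ∀ (b₁ b₂ b₃ : ℝ), 0 < b₁ → 0 < b₂ → 0 < b₃ →
    -- one model for each sample size `N`
    ∀ (Ω : ℕ → Type*) [∀ N, MeasurableSpace (Ω N)] (P : ∀ N, Measure (Ω N))
      [∀ N, IsProbabilityMeasure (P N)]
      (κ r m l : ℕ → ℕ) (γ : ℕ → ℕ → ℝ) (φ : ∀ N, ℕ → Fin (κ N) → ℝ)
      (I ε : ∀ N, Fin N → ImagePCA.Pixel (κ N) → Ω N → ℝ)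
      (Istar : ∀ N, ImagePCA.Pixel (κ N) → ℝ)
      (Sig : ∀ N, ImagePCA.Pixel (κ N) → ImagePCA.Pixel (κ N) → ℝ)
      (σ : ℕ → ℕ → ℝ) (Φ : ∀ N, ℕ → ImagePCA.Pixel (κ N) → ℝ)
      (Phat : ∀ N, Ω N → ImagePCA.Pixel (κ N) → ImagePCA.Pixel (κ N) → ℝ),
    (∀ N, 1 ≤ κ N) →
    (∀ N, ImagePCA.OrthonormalOn (Finset.Icc 1 (κ N)) (φ N)) →
    (∀ N, ∀ k ∈ Finset.Icc 1 (κ N),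
      c₁ * (k : ℝ) ^ (-2 * α) ≤ γ N k ∧ γ N k ≤ c₂ * (k : ℝ) ^ (-2 * α)) →
    (∀ N, ImagePCA.IsSignalNoise (P N) (I N) (ε N) (Istar N) (Sig N) Cδ Cε) →
    (∀ N, ImagePCA.rkhsNormSq (γ N) (φ N) (Sig N) ≤ B ^ 2) →
    (∀ N, ImagePCA.IsSpectral (Sig N) (r N) (σ N) (Φ N)) →
    (∀ᶠ N : ℕ in atTop,
      b₁ * (N : ℝ) ^ (1 / (2 * α + 2)) ≤ m N ∧ (m N : ℝ) ≤ b₂ * (N : ℝ) ^ (1 / (2 * α + 2))) →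
    (∀ᶠ N : ℕ in atTop, 1 ≤ l N ∧ (l N : ℝ) ≤ b₃ * (N : ℝ) ^ (1 / (2 * α + 2))) →
    (∀ᶠ N : ℕ in atTop,
      |σ N (r N)| > C * max (max ((l N : ℝ) ^ (-α)) ((m N : ℝ) ^ (-α)))
        (max (((m N : ℝ) + (l N : ℝ)) / Real.sqrt N) (1 / (κ N : ℝ) ^ 2))) →
    (∀ N ω, ImagePCA.IsLeadingProj
      (ImagePCA.sandwich (ImagePCA.sampleCov (fun i x => I N i x ω + ε N i x ω))
        (ImagePCA.subspaceProj (φ N) (m N)) (ImagePCA.subspaceProj (φ N) (l N)))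
      (r N) (Phat N ω)) →
    ImagePCA.IsBigOP P
      (fun N ω => (ImagePCA.opNorm (fun x y =>
        Phat N ω x y - ImagePCA.projKernel (Finset.Icc 1 (r N)) (Φ N) x y)) ^ 2)
      (fun N => (σ N (r N)) ^ (-2 : ℤ) / (N : ℝ) ^ (2 * α / (2 * α + 2)) +
        (σ N (r N)) ^ (-2 : ℤ) / (κ N : ℝ) ^ 4) := by
  -- With this `C` the gap condition gives `c₂² |B| ℓ^{-α} ≤ σ_r / 2`, as the perturbation bound
  -- requires; it is chosen before `b₁`, `b₂`, `b₃`.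
  refine ⟨2 * (c₂ ^ 2 * |B|) + 1, by positivity, ?_⟩
  intro b₁ b₂ b₃ hb₁ hb₂ hb₃ Ω _ P _ κ r m l γ φ I ε Istar Sig σ Φ Phat hκ hφ hγ hmodel hH hspec
    hm hl hgap hPhat η hη
  set c : ℝ≥0 := Cδ ^ 2 + Cε ^ 2 + 1 with hc
  set A : ℝ := 2000 * c ^ 2 * (b₂ + b₃) + c₂ ^ 2 * |B| * b₁ ^ (-α)
  -- Outside the exceptional event the squared error is at most `(K - 1)` times the positive rate;
  -- the extra `1` makes the contradiction strict.
  refine ⟨512 * (A ^ 2 + (8 * c) ^ 2) + 1, by positivity, ?_⟩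
  have hpow : Tendsto (fun N : ℕ => b₁ * (N : ℝ) ^ (1 / (2 * α + 2))) atTop atTop :=
    ((tendsto_rpow_atTop (by positivity : 0 < 1 / (2 * α + 2))).comp
      tendsto_natCast_atTop_atTop).const_mul_atTop hb₁
  have hmtop : Tendsto (fun N => ((m N ^ 2 + l N ^ 2 : ℕ) : ℝ)) atTop atTop := by
    refine tendsto_atTop_mono' _ ?_ hpow
    filter_upwards [hm] with N h
    refine h.1.trans ?_
    have : m N ≤ m N ^ 2 + l N ^ 2 := (Nat.le_self_pow two_ne_zero _).trans (Nat.le_add_right _ _)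
    exact_mod_cast this
  refine ImagePCA.limsup_lt_ofReal_of_eventually_le hη
    (g := fun N => 6 * Real.exp (-((m N ^ 2 + l N ^ 2 : ℕ) : ℝ))) ?_ ?_
  · simpa using ((Real.tendsto_exp_atBot.comp (tendsto_neg_atTop_atBot.comp hmtop)).const_mul 6)
  filter_upwards [hm, hl, hgap, eventually_ge_atTop 2, ImagePCA.eventually_dimension_le hα
    (hm.mono fun _ h => h.2) (hl.mono fun _ h => h.2)] with N hmN hlN hgapN hN hdim
  have hN0 : (0 : ℝ) < N := by exact_mod_cast (by omega : 0 < N)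
  have hσ := (hspec N).pos
  have hm0 : (0 : ℝ) < m N := lt_of_lt_of_le (by positivity) hmN.1
  have hm1 : 1 ≤ m N := by exact_mod_cast hm0
  have hκ0 : (0 : ℝ) < κ N := by exact_mod_cast hκ N
  have hcB : 0 ≤ c₂ ^ 2 * |B| := by positivity
  have htail := (hmodel N).measure_norm_compression_gt_le (hκ N) (hφ N) (m := m N) (l := l N)
    hm1 hN hdim hc
  have happ : ∀ n : ℕ, 1 ≤ n → ∀ x, ‖ImagePCA.kernelCLM (Sig N) x -
      (ImagePCA.gridSpan (φ N) n).starProjection (ImagePCA.kernelCLM (Sig N) x)‖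
      ≤ c₂ ^ 2 * |B| * (n : ℝ) ^ (-α) * ‖x‖ := fun n hn x =>
    ImagePCA.norm_sub_gridSpan_le (hκ N) (hφ N) hα hc₁ hc₂ (hγ N) (hH N) hn x
  have hlσ : c₂ ^ 2 * |B| * (l N : ℝ) ^ (-α) ≤ σ N (r N) / 2 := by
    rw [abs_of_pos hσ] at hgapN
    have hl0 : 0 ≤ (l N : ℝ) ^ (-α) := by positivity
    have h1 : (l N : ℝ) ^ (-α) ≤ max (max ((l N : ℝ) ^ (-α)) ((m N : ℝ) ^ (-α)))
        (max (((m N : ℝ) + (l N : ℝ)) / Real.sqrt N) (1 / (κ N : ℝ) ^ 2)) :=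
      (le_max_left _ _).trans (le_max_left _ _)
    have h2 := mul_le_mul_of_nonneg_left h1 (by positivity : 0 ≤ 2 * (c₂ ^ 2 * |B|) + 1)
    nlinarith
  set t : ℝ := (N : ℝ) ^ (-(α / (2 * α + 2))) with ht
  have hρ := ImagePCA.sqrt_dimension_div_le (by omega : 1 ≤ N) hα hmN.2 hlN.2
  have hδ : c₂ ^ 2 * |B| * (m N : ℝ) ^ (-α) ≤ c₂ ^ 2 * |B| * b₁ ^ (-α) * t := by
    rw [mul_assoc (c₂ ^ 2 * |B|)]
    refine mul_le_mul_of_nonneg_left ?_ hcB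
    calc (m N : ℝ) ^ (-α) ≤ (b₁ * (N : ℝ) ^ (1 / (2 * α + 2))) ^ (-α) :=
          Real.rpow_le_rpow_of_nonpos (by positivity) hmN.1 (by linarith)
      _ = b₁ ^ (-α) * t := by
          rw [Real.mul_rpow hb₁.le (by positivity), ← Real.rpow_mul hN0.le, ht]
          congr 2
          ring
  rw [← ENNReal.ofReal_toReal (measure_ne_top (P N) _)]
  refine ENNReal.ofReal_le_ofReal (le_trans (measureReal_mono ?_ (measure_ne_top _ _)) htail)
  -- By contraposition: a small projected fluctuation forces the error below `K` times the rate, so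
  -- the event in question lies in the exceptional one.
  intro ω hω
  by_contra hno
  rw [Set.mem_ofPred_eq, not_lt] at hno
  rw [Set.mem_ofPred_eq] at hω
  have hdet := ImagePCA.opNorm_leadingProj_sub_le (hκ N) (hφ N) (hspec N) (hPhat N ω)
    (happ (m N) hm1)
    (fun x => (happ (l N) hlN.1 x).trans (mul_le_mul_of_nonneg_right hlσ (norm_nonneg x)))
    (by positivity)
  have hx0 := ImagePCA.opNorm_nonneg (fun x y =>
    Phat N ω x y - ImagePCA.projKernel (Finset.Icc 1 (r N)) (Φ N) x y)
  set x := ImagePCA.opNorm (fun x y =>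
    Phat N ω x y - ImagePCA.projKernel (Finset.Icc 1 (r N)) (Φ N) x y)
  have hx : x ≤ 16 * (A * t + 8 * c * ((κ N : ℝ) ^ 2)⁻¹) / σ N (r N) := by
    refine hdet.trans (div_le_div_of_nonneg_right
      (mul_le_mul_of_nonneg_left ?_ (by norm_num)) hσ.le)
    have h1 : 2000 * (c : ℝ) ^ 2 * Real.sqrt (((m N ^ 2 + l N ^ 2 : ℕ) : ℝ) / N)
        ≤ 2000 * c ^ 2 * ((b₂ + b₃) * t) := mul_le_mul_of_nonneg_left hρ (by positivity)
    rw [div_eq_mul_inv (8 * (c : ℝ))] at hno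
    simp only [A]
    linarith
  have hsq := ImagePCA.sq_le_of_le_rate hx0 hσ hx
  have ht2 : t ^ 2 = ((N : ℝ) ^ (2 * α / (2 * α + 2)))⁻¹ := by
    rw [ht, ← Real.rpow_natCast, ← Real.rpow_mul hN0.le, ← Real.rpow_neg hN0.le]
    congr 1
    push_cast
    ring
  have ha : ((σ N (r N)) ^ 2)⁻¹ * t ^ 2 + ((σ N (r N)) ^ 2)⁻¹ * (((κ N : ℝ) ^ 2)⁻¹) ^ 2
      = (σ N (r N)) ^ (-2 : ℤ) / (N : ℝ) ^ (2 * α / (2 * α + 2)) +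
        (σ N (r N)) ^ (-2 : ℤ) / (κ N : ℝ) ^ 4 := by
    rw [ht2, div_eq_mul_inv, div_eq_mul_inv, zpow_neg, inv_pow, ← pow_mul]
    rfl
  rw [ha] at hsq
  set a := (σ N (r N)) ^ (-2 : ℤ) / (N : ℝ) ^ (2 * α / (2 * α + 2)) +
    (σ N (r N)) ^ (-2 : ℤ) / (κ N : ℝ) ^ 4
  have ha0 : 0 < a := by positivity
  rw [abs_of_nonneg (by positivity), le_div_iff₀ ha0] at hω
  linarith
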